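/- Let a spacetime be given in double null coordinates $(u,\underline u,\omega)$, with $(u,\underline u)$ in an open subset $D\subset\mathbb R^2$ and $\omega\in\mathbb S^2$ with local coordinates $(\theta^1,\theta^2)$, by a smooth metric $$g=-2\Omega^2(du\otimes d\underline u+d\underline u\otimes du)+\gamma_{AB}(d\theta^A-d^Ad\underline u)\otimes(d\theta^B-d^Bd\underline u),\qquad \Omega>0,$$ where $\gamma$ is positive definite. Let $D_XY$ be its Levi-Civita connection, $e_3=\Omega^{-1}\partial_u$, $e_4=\Omega^{-1}(\partial_{\underline u}+d^A\partial_{\theta^A})$, and let $(e_1,e_2)$ be a local $C^1$ orthonormal frame tangent to the spheres $S_{u,\underline u}$ (on which $u,\underline u$ are constant). Put $$\chi_{ab}=g(D_{e_a}e_4,e_b),\quad \underline\chi_{ab}=g(D_{e_a}e_3,e_b),\quad \eta_a=-\tfrac12 g(D_{e_3}e_a,e_4),\quad \underline\omega=-\tfrac14 g(D_{e_3}e_4,e_3),$$ let $\mathrm{tr}\chi,\mathrm{tr}\underline\chi$ be the traces over $a=b\in\{1,2\}$, and let $\hat{\underline\chi}_{ab}=\underline\chi_{ab}-\tfrac12\mathrm{tr}\underline\chi\,\delta_{ab}$.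 Fix $\underline u$ and a $C^2$ function $R:\mathbb S^2\to\mathbb R$ such that the sphere $M=\{u=1-R(\omega)\}$ on the incoming null cone $\underline H_{\underline u}$ (the level set of $\underline u$) lies in the spacetime, and regard $R$ as a function on the spacetime that does not depend on $u,\underline u$. Write $\nabla_aR=e_a(R)$, $|\nabla R|^2=\sum_a e_a(R)^2$, $\eta\cdot\nabla R=\sum_a\eta_a e_a(R)$. Let $\Delta'_M$ be the Laplace–Beltrami operator of the metric that $g$ induces on $M$, let $\Delta$ be the Laplace–Beltrami operator of $S_{u,\underline u}$, and let $$e^ae_a(R)=\sum_a\big(e_a(e_aR)-(\nabla_{e_a}e_a)R\big),$$ where $\nabla_{e_a}e_a=\sum_b g(D_{e_a}e_a,e_b)e_b$ is the induced covariant derivative on $S_{u,\underline u}$. Define the deformed null frame $$e_3'=e_3,\quad e_a'=e_a-\Omega e_a(R)e_3,\quad e_4'=e_4-2\Omega\sum_a e_a(R)e_a+\Omega^2|\nabla R|^2e_3,$$ and the outgoing null expansion $\mathrm{tr}\chi'=\sum_a g(D_{e_a'}e_4',e_a')$ of $M$. Then at every point $(1-R(\omega),\underline u,\omega)$ of $M$,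 with all quantities on the right evaluated there (and $\Delta$ taken on the sphere $S_{1-R(\omega),\underline u}$ through that point), $$e^ae_a(R)=\Delta R=\Delta'_MR-2\Omega\,\hat{\underline\chi}_{ab}\nabla^aR\nabla^bR,$$ $$\mathrm{tr}\chi'=\mathrm{tr}\chi-2\Omega\Delta'_MR-4\Omega\,\eta\cdot\nabla R-\Omega^2\,\mathrm{tr}\underline\chi\,|\nabla R|^2-8\Omega^2\underline\omega|\nabla R|^2.$$ -/

import Mathlib

open scoped Manifold ContDiff Topology

noncomputable section

/-- The unit 2-sphere, whose points label the null generators of the incoming cones. -/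
abbrev S2 : Type := Metric.sphere (0 : EuclideanSpace ℝ (Fin 3)) 1

/-- The plane in which local coordinates `(θ¹, θ²)` of the sphere take their values. -/
abbrev E2 : Type := EuclideanSpace ℝ (Fin 2)

/-- Local coordinate systems of the sphere. -/
abbrev Chart : Type := OpenPartialHomeomorph S2 E2

/-- Spacetime coordinates `x = (u, ū, θ¹, θ²)`; the same type holds the components
`(Vᵘ, Vᵘ̄, V¹, V²)` of spacetime vectors in these coordinates. -/
abbrev Coord : Type := Fin 4 → ℝ

/-- The angular part `(θ¹, θ²)` of `x = (u, ū, θ¹, θ²)`. -/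
def ang (x : Coord) : E2 := !₂[x 2, x 3]

/-- The coordinates `(u, ū, θ¹, θ²)` put together. -/
def pt (u ub : ℝ) (θ : E2) : Coord := ![u, ub, θ 0, θ 1]

/-- The coordinate vector field `∂/∂θᴬ` of a chart of the sphere. -/
def coordVec (c : Chart) (θ : E2) (A : Fin 2) : TangentSpace (𝓡 2) (c.symm θ) :=
  mfderiv (𝓡 2) (𝓡 2) c.symm θ (EuclideanSpace.single A (1 : ℝ) : E2)

/-- The component `vᴬ` of a vector tangent to the sphere, in a chart of the sphere. -/
def vecComp (c : Chart) (q : S2) (v : TangentSpace (𝓡 2) q) (A : Fin 2) : ℝ :=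
  (EuclideanSpace.proj A : E2 →L[ℝ] ℝ) (mfderiv (𝓡 2) (𝓡 2) c q v)

/-- A spacetime foliated by a double null foliation, in its canonical coordinates
`(u, ū, ω)`, `ω ∈ 𝕊²`, where `(u, ū)` ranges over an open set `dom`.  The data are the lapse
`Ω > 0`, the Riemannian metrics `γ(u, ū)` induced on the spheres `S_{u,ū}`, and the shift `d(u, ū)`,
a vector field tangent to these spheres; they are smooth, that is, their components in every
coordinate system of the sphere are smooth functions of `(u, ū, θ¹, θ²)`.
The spacetime metric that they determine is `DoubleNull.metric` below. -/
structure DoubleNull where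
  dom : Set (ℝ × ℝ)
  isOpen_dom : IsOpen dom
  Omega : ℝ → ℝ → S2 → ℝ
  gamma : ℝ → ℝ → ∀ q : S2, TangentSpace (𝓡 2) q →L[ℝ] TangentSpace (𝓡 2) q →L[ℝ] ℝ
  shift : ℝ → ℝ → ∀ q : S2, TangentSpace (𝓡 2) q
  Omega_pos : ∀ u ub q, (u, ub) ∈ dom → 0 < Omega u ub q
  gamma_symm : ∀ u ub q, (u, ub) ∈ dom → ∀ v w, gamma u ub q v w = gamma u ub q w v
  gamma_pos : ∀ u ub q, (u, ub) ∈ dom → ∀ v, v ≠ 0 → 0 < gamma u ub q v v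
  Omega_smooth : ∀ c ∈ IsManifold.maximalAtlas (𝓡 2) ∞ S2,
    ContDiffOn ℝ ∞ (fun x : Coord => Omega (x 0) (x 1) (c.symm (ang x)))
      {x | (x 0, x 1) ∈ dom ∧ ang x ∈ c.target}
  gamma_smooth : ∀ c ∈ IsManifold.maximalAtlas (𝓡 2) ∞ S2, ∀ A B : Fin 2,
    ContDiffOn ℝ ∞ (fun x : Coord => gamma (x 0) (x 1) (c.symm (ang x))
        (coordVec c (ang x) A) (coordVec c (ang x) B))
      {x | (x 0, x 1) ∈ dom ∧ ang x ∈ c.target}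
  shift_smooth : ∀ c ∈ IsManifold.maximalAtlas (𝓡 2) ∞ S2, ∀ A : Fin 2,
    ContDiffOn ℝ ∞ (fun x : Coord =>
        vecComp c (c.symm (ang x)) (shift (x 0) (x 1) (c.symm (ang x))) A)
      {x | (x 0, x 1) ∈ dom ∧ ang x ∈ c.target}

/-- The Laplace–Beltrami operator of a Riemannian metric `h` on a surface, in local coordinates:
`Δ_h f = (det h)^{-1/2} ∂_A ((det h)^{1/2} h^{AB} ∂_B f)`. -/
def laplaceBeltrami (h : E2 → Matrix (Fin 2) (Fin 2) ℝ) (f : E2 → ℝ) (θ : E2) : ℝ :=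
  (√(h θ).det)⁻¹ * ∑ A : Fin 2, ∑ B : Fin 2,
    fderiv ℝ (fun θ' => √(h θ').det * (h θ')⁻¹ A B *
      fderiv ℝ f θ' (EuclideanSpace.single B (1 : ℝ))) θ (EuclideanSpace.single A (1 : ℝ))

/-- The derivative `X(f)` of a function along a spacetime vector field. -/
def along (X : Coord → Coord) (f : Coord → ℝ) (x : Coord) : ℝ := fderiv ℝ f x (X x)

/-- A function of `ω ∈ 𝕊²` as a function of `(u, ū, θ¹, θ²)`, independent of `u` and `ū`. -/
def onSpacetime (c : Chart) (R : S2 → ℝ) (x : Coord) : ℝ := R (c.symm (ang x))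

namespace DoubleNull

variable (G : DoubleNull) (c : Chart)

/-- The range of the coordinates `(u, ū, θ¹, θ²)`. -/
def coordDom : Set Coord := {x | (x 0, x 1) ∈ G.dom ∧ ang x ∈ c.target}

/-- `Ω` in coordinates. -/
def lapse (x : Coord) : ℝ := G.Omega (x 0) (x 1) (c.symm (ang x))

/-- The components `γ_{AB}`. -/
def gammaC (x : Coord) (A B : Fin 2) : ℝ :=
  G.gamma (x 0) (x 1) (c.symm (ang x)) (coordVec c (ang x) A) (coordVec c (ang x) B)

/-- The components `dᴬ`. -/
def shiftC (x : Coord) (A : Fin 2) : ℝ :=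
  vecComp c (c.symm (ang x)) (G.shift (x 0) (x 1) (c.symm (ang x))) A

/-- The one-forms `dθᴬ - dᴬ dū`. -/
def angForm (x : Coord) (A : Fin 2) (V : Coord) : ℝ := V (Fin.natAdd 2 A) - G.shiftC c x A * V 1

/-- The spacetime metric
`g = -2 Ω² (du ⊗ dū + dū ⊗ du) + γ_{AB} (dθᴬ - dᴬ dū) ⊗ (dθᴮ - dᴮ dū)`. -/
def metric (x : Coord) (V W : Coord) : ℝ :=
  -2 * G.lapse c x ^ 2 * (V 0 * W 1 + V 1 * W 0) +
    ∑ A : Fin 2, ∑ B : Fin 2, G.gammaC c x A B * G.angForm c x A V * G.angForm c x B W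

/-- The components `g_{μν}`. -/
def metricC (x : Coord) : Matrix (Fin 4) (Fin 4) ℝ :=
  Matrix.of fun μ ν => G.metric c x (Pi.single μ 1) (Pi.single ν 1)

/-- `∂_κ g_{μν}`. -/
def dMetricC (κ μ ν : Fin 4) (x : Coord) : ℝ :=
  fderiv ℝ (fun y => G.metricC c y μ ν) x (Pi.single κ 1)

/-- The Christoffel symbols `Γ^μ_{νκ} = ½ g^{μσ} (∂_ν g_{σκ} + ∂_κ g_{σν} - ∂_σ g_{νκ})`. -/
def christoffel (μ ν κ : Fin 4) (x : Coord) : ℝ :=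
  1 / 2 * ∑ σ : Fin 4, (G.metricC c x)⁻¹ μ σ *
    (G.dMetricC c ν σ κ x + G.dMetricC c κ σ ν x - G.dMetricC c σ ν κ x)

/-- The Levi-Civita connection `D` of the spacetime metric:
`(D_X Y)^μ = X^ν ∂_ν Y^μ + Γ^μ_{νκ} X^ν Y^κ`. -/
def cov (X Y : Coord → Coord) (x : Coord) : Coord := fun μ =>
  along X (fun y => Y y μ) x + ∑ ν : Fin 4, ∑ κ : Fin 4, G.christoffel c μ ν κ x * X x ν * Y x κ

/-- `e₃ = Ω⁻¹ ∂/∂u`. -/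
def e3 (x : Coord) : Coord := (G.lapse c x)⁻¹ • ![1, 0, 0, 0]

/-- `e₄ = Ω⁻¹ (∂/∂ū + dᴬ ∂/∂θᴬ)`. -/
def e4 (x : Coord) : Coord := (G.lapse c x)⁻¹ • ![0, 1, G.shiftC c x 0, G.shiftC c x 1]

/-- `(e₁, e₂)` is, on `U`, a continuously differentiable orthonormal frame for the tangent spaces
of the spheres `S_{u,ū}`. -/
structure IsSphereFrame (U : Set Coord) (e : Fin 2 → Coord → Coord) : Prop where
  contDiffOn : ∀ a, ContDiffOn ℝ 1 (e a) U
  tangent : ∀ a, ∀ x ∈ U, e a x 0 = 0 ∧ e a x 1 = 0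
  orthonormal : ∀ a b, ∀ x ∈ U, G.metric c x (e a x) (e b x) = if a = b then 1 else 0

variable (e : Fin 2 → Coord → Coord)

/-- `χ_{ab} = g(D_{e_a} e₄, e_b)`. -/
def chi (a b : Fin 2) (x : Coord) : ℝ := G.metric c x (G.cov c (e a) (G.e4 c) x) (e b x)

/-- `χ̲_{ab} = g(D_{e_a} e₃, e_b)`. -/
def chib (a b : Fin 2) (x : Coord) : ℝ := G.metric c x (G.cov c (e a) (G.e3 c) x) (e b x)

/-- `tr χ`. -/
def trChi (x : Coord) : ℝ := ∑ a, G.chi c e a a x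

/-- `tr χ̲`. -/
def trChib (x : Coord) : ℝ := ∑ a, G.chib c e a a x

/-- The traceless part of `χ̲`. -/
def chibHat (a b : Fin 2) (x : Coord) : ℝ :=
  G.chib c e a b x - 1 / 2 * G.trChib c e x * (if a = b then 1 else 0)

/-- `η_a = -½ g(D_{e₃} e_a, e₄)`. -/
def eta (a : Fin 2) (x : Coord) : ℝ :=
  -(1 / 2) * G.metric c x (G.cov c (G.e3 c) (e a) x) (G.e4 c x)

/-- `ω̲ = -¼ g(D_{e₃} e₄, e₃)`. -/
def omegab (x : Coord) : ℝ :=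
  -(1 / 4) * G.metric c x (G.cov c (G.e3 c) (G.e4 c) x) (G.e3 c x)

/-- `|∇f|² = ∑ₐ (e_a f)²`. -/
def gradSq (f : Coord → ℝ) (x : Coord) : ℝ := ∑ a, along (e a) f x ^ 2

/-- `eᵃe_a(f) = ∑ₐ (e_a (e_a f) - (∇_{e_a} e_a) f)`, where `∇`, the induced connection of the spheres
`S_{u,ū}`, is the projection of `D` to their tangent spaces:
`∇_{e_a} e_a = ∑_b g(D_{e_a} e_a, e_b) e_b`. -/
def frameLaplacian (f : Coord → ℝ) (x : Coord) : ℝ :=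
  ∑ a, (along (e a) (along (e a) f) x -
    ∑ b, G.metric c x (G.cov c (e a) (e a) x) (e b x) * along (e b) f x)

/-- `e'_a = e_a - Ω e_a(f) e₃`. -/
def defFrame (f : Coord → ℝ) (a : Fin 2) (x : Coord) : Coord :=
  e a x - (G.lapse c x * along (e a) f x) • G.e3 c x

/-- `e'₄ = e₄ - 2 Ω eᵃ(f) e_a + Ω² |∇f|² e₃`. -/
def defE4 (f : Coord → ℝ) (x : Coord) : Coord :=
  G.e4 c x - (2 * G.lapse c x) • ∑ a, along (e a) f x • e a x +
    (G.lapse c x ^ 2 * gradSq e f x) • G.e3 c x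

/-- `tr χ' = ∑ₐ g(D_{e'_a} e'₄, e'_a)`. -/
def trChiDef (f : Coord → ℝ) (x : Coord) : ℝ :=
  ∑ a, G.metric c x (G.cov c (G.defFrame c e f a) (G.defE4 c e f) x) (G.defFrame c e f a x)

/-- The metric `h_{AB} = g(∂_A F, ∂_B F)` that the spacetime metric induces on the surface
parametrized by `F`. -/
def inducedMetric (F : E2 → Coord) (θ : E2) : Matrix (Fin 2) (Fin 2) ℝ :=
  Matrix.of fun A B => G.metric c (F θ) (fderiv ℝ F θ (EuclideanSpace.single A (1 : ℝ)))
    (fderiv ℝ F θ (EuclideanSpace.single B (1 : ℝ)))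

/-- The Laplace–Beltrami operator of `S_{u,ū}`, applied to a function of `ω`. -/
def sphereLaplacian (u ub : ℝ) (f : S2 → ℝ) (θ : E2) : ℝ :=
  laplaceBeltrami (G.inducedMetric c fun θ' => pt u ub θ') (fun θ' => f (c.symm θ')) θ

/-- The Laplace–Beltrami operator `Δ'_M` of the deformed sphere `M = {u = 1 - R(ω)}` on the incoming
cone with the given `ū`, applied to a function of `ω`. -/
def deformedLaplacian (ub : ℝ) (R f : S2 → ℝ) (θ : E2) : ℝ :=
  laplaceBeltrami (G.inducedMetric c fun θ' => pt (1 - R (c.symm θ')) ub θ')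
    (fun θ' => f (c.symm θ')) θ

end DoubleNull

end

/-! In `g` the differential `du` occurs only multiplied by `dū`, so on an incoming cone `∂_u` is
degenerate and every surface `u = w(θ)` carries the metric `γ_{AB}(w(θ), ū, θ)`, with no
contribution from `dw` (`inducedMetric_pt`). The angular components `e_aᴬ`, restricted to the
surface, therefore form an orthonormal frame for it, and its Laplacian is the frame formula
`laplaceBeltrami_eq_of_frame`. Differentiating along the surface replaces `∂_A` by `∂_A + (∂_A w) Ω
e₃`. For constant `w` nothing is added, and torsion-freeness identifies the result with `eᵃe_a(R)`;
for `w = 1 - R` there are extra terms in `e₃(e_aᴬ)`. By `chib_eq` these are `-χ̲` up to the rotation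
`g(D_{e₃} e_a, e_b)`, which is antisymmetric and drops out of traces and quadratic forms. What
remains is `2Ω χ̲̂(∇R, ∇R)`. One lemma, `laplaceBeltrami_inducedMetric_pt`, treats both surfaces.

The expansion is found by the Leibniz rule (`metric_cov_defE4_defFrame`) and the Ricci coefficients
of the null frame (`trChiDef_eq`). The derivatives `e_a Ω` cancel, while `η`, `ω̲` and `χ̲(∇R, ∇R)`
each arise twice. Passing from `eᵃe_a(R)` to `Δ'_M R` then trades `χ̲(∇R, ∇R)` for its trace part.
-/

/-! ### Calculus of derivatives along vector fields. -/

/-- The components of the commutator `[X, Y]` of two spacetime vector fields. -/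
noncomputable def bracket (X Y : Coord → Coord) (x : Coord) : Coord := fun μ =>
  along X (fun y => Y y μ) x - along Y (fun y => X y μ) x

lemma along_eq_sum (X : Coord → Coord) (f : Coord → ℝ) (x : Coord) :
    along X f x = ∑ κ, X x κ * fderiv ℝ f x (Pi.single κ 1) := by
  have h : X x = ∑ κ, X x κ • (Pi.single κ (1 : ℝ) : Coord) := by
    ext i; simp [Finset.sum_apply, Pi.single_apply]
  unfold along
  conv_lhs => rw [h]
  simp only [map_sum, map_smul, smul_eq_mul]

lemma along_mul {X : Coord → Coord} {f g : Coord → ℝ} {x : Coord}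
    (hf : DifferentiableAt ℝ f x) (hg : DifferentiableAt ℝ g x) :
    along X (fun y => f y * g y) x = f x * along X g x + along X f x * g x := by
  unfold along
  rw [fderiv_fun_mul hf hg]
  simp [mul_comm]

lemma along_add {X : Coord → Coord} {f g : Coord → ℝ} {x : Coord}
    (hf : DifferentiableAt ℝ f x) (hg : DifferentiableAt ℝ g x) :
    along X (fun y => f y + g y) x = along X f x + along X g x := by
  unfold along
  rw [fderiv_fun_add hf hg]
  simp

lemma along_sub {X : Coord → Coord} {f g : Coord → ℝ} {x : Coord}
    (hf : DifferentiableAt ℝ f x) (hg : DifferentiableAt ℝ g x) :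
    along X (fun y => f y - g y) x = along X f x - along X g x := by
  unfold along
  rw [fderiv_fun_sub hf hg]
  simp

lemma along_sum {ι : Type*} {s : Finset ι} {X : Coord → Coord} {f : ι → Coord → ℝ} {x : Coord}
    (hf : ∀ i, DifferentiableAt ℝ (f i) x) :
    along X (fun y => ∑ i ∈ s, f i y) x = ∑ i ∈ s, along X (f i) x := by
  unfold along
  rw [fderiv_fun_sum fun i _ => hf i]
  simp

lemma along_const (X : Coord → Coord) (r : ℝ) (x : Coord) : along X (fun _ => r) x = 0 := by
  simp [along]

lemma along_congr {X : Coord → Coord} {f g : Coord → ℝ} {x : Coord} (h : f =ᶠ[𝓝 x] g) :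
    along X f x = along X g x := by
  unfold along
  rw [h.fderiv_eq]

lemma continuous_ang : Continuous ang := by
  unfold ang
  fun_prop

lemma contDiff_ang {n : WithTop ℕ∞} : ContDiff ℝ n ang := by
  unfold ang
  refine (contDiff_euclidean (n := n)).2 fun i => ?_
  fin_cases i
  · simpa using contDiff_apply ℝ ℝ (2 : Fin 4)
  · simpa using contDiff_apply ℝ ℝ (3 : Fin 4)

/-! ### The metric and its Levi-Civita connection. -/

namespace DoubleNull

variable (G : DoubleNull) (c : Chart)

lemma isOpen_coordDom : IsOpen (G.coordDom c) := by
  have h1 : Continuous fun x : Coord => (x 0, x 1) := by fun_prop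
  exact (G.isOpen_dom.preimage h1).inter (c.open_target.preimage continuous_ang)

lemma metric_eq_sum (x V W : Coord) :
    G.metric c x V W = ∑ μ, ∑ ν, G.metricC c x μ ν * V μ * W ν := by
  simp [metric, metricC, angForm, Fin.sum_univ_four, Fin.sum_univ_two, Pi.single_apply]
  ring

lemma metric_add_left (x V V' W : Coord) :
    G.metric c x (V + V') W = G.metric c x V W + G.metric c x V' W := by
  simp only [metric_eq_sum, ← Finset.sum_add_distrib]
  exact Finset.sum_congr rfl fun _ _ => Finset.sum_congr rfl fun _ _ => by simp; ring

lemma metric_sub_left (x V V' W : Coord) :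
    G.metric c x (V - V') W = G.metric c x V W - G.metric c x V' W := by
  simp only [metric_eq_sum, ← Finset.sum_sub_distrib]
  exact Finset.sum_congr rfl fun _ _ => Finset.sum_congr rfl fun _ _ => by simp; ring

lemma metric_sub_right (x V W W' : Coord) :
    G.metric c x V (W - W') = G.metric c x V W - G.metric c x V W' := by
  simp only [metric_eq_sum, ← Finset.sum_sub_distrib]
  exact Finset.sum_congr rfl fun _ _ => Finset.sum_congr rfl fun _ _ => by simp; ring

lemma metric_smul_left (x : Coord) (r : ℝ) (V W : Coord) :
    G.metric c x (r • V) W = r * G.metric c x V W := by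
  simp only [metric_eq_sum, Finset.mul_sum]
  exact Finset.sum_congr rfl fun _ _ => Finset.sum_congr rfl fun _ _ => by simp; ring

lemma metric_smul_right (x : Coord) (r : ℝ) (V W : Coord) :
    G.metric c x V (r • W) = r * G.metric c x V W := by
  simp only [metric_eq_sum, Finset.mul_sum]
  exact Finset.sum_congr rfl fun _ _ => Finset.sum_congr rfl fun _ _ => by simp; ring

variable {G c}

lemma gammaC_symm {x : Coord} (hx : x ∈ G.coordDom c) (A B : Fin 2) :
    G.gammaC c x A B = G.gammaC c x B A :=
  G.gamma_symm _ _ _ hx.1 _ _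

lemma metric_symm {x : Coord} (hx : x ∈ G.coordDom c) (V W : Coord) :
    G.metric c x V W = G.metric c x W V := by
  simp only [metric, Fin.sum_univ_two, gammaC_symm hx 1 0]
  ring

lemma metricC_symm {x : Coord} (hx : x ∈ G.coordDom c) (μ ν : Fin 4) :
    G.metricC c x μ ν = G.metricC c x ν μ :=
  metric_symm hx _ _

lemma lapse_pos {x : Coord} (hx : x ∈ G.coordDom c) : 0 < G.lapse c x :=
  G.Omega_pos _ _ _ hx.1

lemma differentiableAt_lapse (hc : c ∈ IsManifold.maximalAtlas (𝓡 2) ∞ S2) {x : Coord}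
    (hx : x ∈ G.coordDom c) : DifferentiableAt ℝ (G.lapse c) x :=
  ((G.Omega_smooth c hc).contDiffAt ((G.isOpen_coordDom c).mem_nhds hx)).differentiableAt
    (by simp)

lemma differentiableAt_gammaC (hc : c ∈ IsManifold.maximalAtlas (𝓡 2) ∞ S2) {x : Coord}
    (hx : x ∈ G.coordDom c) (A B : Fin 2) :
    DifferentiableAt ℝ (fun y => G.gammaC c y A B) x :=
  ((G.gamma_smooth c hc A B).contDiffAt ((G.isOpen_coordDom c).mem_nhds hx)).differentiableAt
    (by simp)

lemma differentiableAt_shiftC (hc : c ∈ IsManifold.maximalAtlas (𝓡 2) ∞ S2) {x : Coord}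
    (hx : x ∈ G.coordDom c) (A : Fin 2) :
    DifferentiableAt ℝ (fun y => G.shiftC c y A) x :=
  ((G.shift_smooth c hc A).contDiffAt ((G.isOpen_coordDom c).mem_nhds hx)).differentiableAt
    (by simp)

lemma differentiableAt_metricC (hc : c ∈ IsManifold.maximalAtlas (𝓡 2) ∞ S2) {x : Coord}
    (hx : x ∈ G.coordDom c) (μ ν : Fin 4) :
    DifferentiableAt ℝ (fun y => G.metricC c y μ ν) x := by
  have h1 := differentiableAt_lapse hc hx
  have h2 := differentiableAt_gammaC hc hx
  have h3 := differentiableAt_shiftC hc hx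
  simp only [metricC, metric, angForm, Matrix.of_apply]
  fun_prop

lemma dMetricC_symm {x : Coord} (hx : x ∈ G.coordDom c) (κ μ ν : Fin 4) :
    G.dMetricC c κ μ ν x = G.dMetricC c κ ν μ x := by
  have h : (fun y => G.metricC c y μ ν) =ᶠ[𝓝 x] fun y => G.metricC c y ν μ := by
    filter_upwards [(G.isOpen_coordDom c).mem_nhds hx] with y hy using metricC_symm hy μ ν
  unfold dMetricC
  rw [h.fderiv_eq]

lemma christoffel_symm {x : Coord} (hx : x ∈ G.coordDom c) (μ ν κ : Fin 4) :
    G.christoffel c μ ν κ x = G.christoffel c μ κ ν x := by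
  unfold christoffel
  congr 1
  refine Finset.sum_congr rfl fun σ _ => ?_
  rw [dMetricC_symm hx σ ν κ]
  ring

/-- Lowering the index cancels the inverse matrix, so compatibility becomes an identity between
derivatives of `g`. Nondegeneracy is assumed here and obtained from a sphere frame in `isUnit_det`.
-/
lemma sum_metricC_mul_christoffel {x : Coord} (hdet : IsUnit (G.metricC c x).det)
    (l ν κ : Fin 4) :
    ∑ μ, G.metricC c x l μ * G.christoffel c μ ν κ x =
      1 / 2 * (G.dMetricC c ν l κ x + G.dMetricC c κ l ν x - G.dMetricC c l ν κ x) := by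
  set T : Fin 4 → ℝ := fun σ =>
    G.dMetricC c ν σ κ x + G.dMetricC c κ σ ν x - G.dMetricC c σ ν κ x with hT
  have h : (fun μ => G.christoffel c μ ν κ x) = (1 / 2 : ℝ) • (G.metricC c x)⁻¹.mulVec T := by
    ext μ
    simp [christoffel, Matrix.mulVec, dotProduct, hT]
  have h2 : (G.metricC c x).mulVec (fun μ => G.christoffel c μ ν κ x) = (1 / 2 : ℝ) • T := by
    rw [h, Matrix.mulVec_smul, Matrix.mulVec_mulVec, Matrix.mul_nonsing_inv _ hdet,
      Matrix.one_mulVec]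
  simpa [Matrix.mulVec, dotProduct] using congrFun h2 l

/-- The Levi-Civita connection is compatible with the metric. -/
lemma along_metric (hc : c ∈ IsManifold.maximalAtlas (𝓡 2) ∞ S2) {x : Coord}
    (hx : x ∈ G.coordDom c) (hdet : IsUnit (G.metricC c x).det) (X : Coord → Coord)
    {Y Z : Coord → Coord} (hY : DifferentiableAt ℝ Y x) (hZ : DifferentiableAt ℝ Z x) :
    along X (fun y => G.metric c y (Y y) (Z y)) x =
      G.metric c x (G.cov c X Y x) (Z x) + G.metric c x (Y x) (G.cov c X Z x) := by
  have hg := differentiableAt_metricC hc hx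
  have hY' := differentiableAt_pi.1 hY
  have hZ' := differentiableAt_pi.1 hZ
  have lower : ∀ (V W : Coord → Coord), G.metric c x (V x) (G.cov c X W x) =
      ∑ l, ∑ μ, G.metricC c x l μ * V x l * along X (fun y => W y μ) x +
      ∑ l, ∑ ν, ∑ κ, 1 / 2 * (G.dMetricC c ν l κ x + G.dMetricC c κ l ν x - G.dMetricC c l ν κ x)
        * V x l * X x ν * W x κ := by
    intro V W
    rw [metric_eq_sum, ← Finset.sum_add_distrib]
    refine Finset.sum_congr rfl fun l _ => ?_
    simp only [← sum_metricC_mul_christoffel hdet, cov, mul_add, Finset.sum_add_distrib,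
      Finset.sum_mul, Finset.mul_sum]
    congr 1
    rw [Finset.sum_comm]
    refine Finset.sum_congr rfl fun ν _ => ?_
    rw [Finset.sum_comm]
    exact Finset.sum_congr rfl fun κ _ => Finset.sum_congr rfl fun μ _ => by ring
  rw [metric_symm hx (G.cov c X Y x), lower Z Y, lower Y Z]
  simp only [metric_eq_sum]
  rw [along_sum (fun μ => by fun_prop)]
  have e1 : ∀ μ, along X (fun y => ∑ ν, G.metricC c y μ ν * Y y μ * Z y ν) x =
      ∑ ν, (G.metricC c x μ ν * Z x ν * along X (fun y => Y y μ) x +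
        G.metricC c x μ ν * Y x μ * along X (fun y => Z y ν) x +
        ∑ κ, X x κ * G.dMetricC c κ μ ν x * Y x μ * Z x ν) := by
    intro μ
    rw [along_sum (fun ν => by fun_prop)]
    refine Finset.sum_congr rfl fun ν _ => ?_
    rw [along_mul (by fun_prop) (by fun_prop), along_mul (by fun_prop) (by fun_prop),
      along_eq_sum X (fun y => G.metricC c y μ ν)]
    simp only [dMetricC, Finset.sum_mul, add_mul]
    ring
  simp only [e1, Finset.sum_add_distrib]
  have e2 : ∑ l, ∑ μ, G.metricC c x l μ * Z x l * along X (fun y => Y y μ) x =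
      ∑ l, ∑ μ, G.metricC c x l μ * Z x μ * along X (fun y => Y y l) x := by
    rw [Finset.sum_comm]
    exact Finset.sum_congr rfl fun _ _ => Finset.sum_congr rfl fun _ _ => by
      rw [metricC_symm hx]
  have e3 : ∑ l, ∑ ν, ∑ κ, 1 / 2 *
      (G.dMetricC c ν l κ x + G.dMetricC c κ l ν x - G.dMetricC c l ν κ x)
        * Z x l * X x ν * Y x κ = ∑ l, ∑ ν, ∑ κ, 1 / 2 *
      (G.dMetricC c ν l κ x - G.dMetricC c κ l ν x + G.dMetricC c l ν κ x)
        * Y x l * X x ν * Z x κ := by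
    rw [Finset.sum_comm, Finset.sum_comm (s := Finset.univ (α := Fin 4))
      (t := Finset.univ (α := Fin 4)) (f := fun l ν => ∑ κ, 1 / 2 *
      (G.dMetricC c ν l κ x - G.dMetricC c κ l ν x + G.dMetricC c l ν κ x)
        * Y x l * X x ν * Z x κ)]
    refine Finset.sum_congr rfl fun ν _ => ?_
    rw [Finset.sum_comm]
    refine Finset.sum_congr rfl fun κ _ => Finset.sum_congr rfl fun l _ => ?_
    rw [dMetricC_symm hx ν l κ, dMetricC_symm hx κ l ν, dMetricC_symm hx l ν κ]
    ring
  rw [e2, e3]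
  -- In the sum of the two lowered Christoffel symbols all but the derivative of `g` along `X`
  -- cancels.
  have e4 : ∑ μ, ∑ ν, ∑ κ, X x κ * G.dMetricC c κ μ ν x * Y x μ * Z x ν =
      ∑ l, ∑ ν, ∑ κ, 1 / 2 *
      (G.dMetricC c ν l κ x - G.dMetricC c κ l ν x + G.dMetricC c l ν κ x)
        * Y x l * X x ν * Z x κ + ∑ l, ∑ ν, ∑ κ, 1 / 2 *
      (G.dMetricC c ν l κ x + G.dMetricC c κ l ν x - G.dMetricC c l ν κ x)
        * Y x l * X x ν * Z x κ := by
    simp only [← Finset.sum_add_distrib]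
    refine Finset.sum_congr rfl fun l _ => ?_
    rw [Finset.sum_comm]
    exact Finset.sum_congr rfl fun _ _ => Finset.sum_congr rfl fun _ _ => by ring
  rw [e4]
  ring

/-- The Levi-Civita connection is free of torsion. -/
lemma cov_eq_cov_add_bracket {x : Coord} (hx : x ∈ G.coordDom c) (X Y : Coord → Coord) :
    G.cov c X Y x = G.cov c Y X x + bracket X Y x := by
  ext μ
  have h : ∑ ν, ∑ κ, G.christoffel c μ ν κ x * X x ν * Y x κ =
      ∑ ν, ∑ κ, G.christoffel c μ ν κ x * Y x ν * X x κ := by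
    rw [Finset.sum_comm]
    exact Finset.sum_congr rfl fun ν _ => Finset.sum_congr rfl fun κ _ => by
      rw [christoffel_symm hx]; ring
  simp only [cov, bracket, Pi.add_apply, h]
  ring

variable (G c)

/-- The direction enters pointwise, so `f` is never differentiated. It is applied to `e'_a = e_a - Ω
e_a(R) e₃`. -/
lemma cov_sub_smul_left (X Z Y : Coord → Coord) (f : Coord → ℝ) (x : Coord) :
    G.cov c (fun y => X y - f y • Z y) Y x = G.cov c X Y x - f x • G.cov c Z Y x := by
  ext μ
  simp only [cov, along, map_sub, map_smul, Pi.sub_apply, Pi.smul_apply, smul_eq_mul, mul_sub,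
    sub_mul, Finset.sum_sub_distrib, mul_add, Finset.mul_sum]
  have h : ∑ ν, ∑ κ, G.christoffel c μ ν κ x * (f x * Z x ν) * Y x κ =
      ∑ ν, ∑ κ, f x * (G.christoffel c μ ν κ x * Z x ν * Y x κ) :=
    Finset.sum_congr rfl fun _ _ => Finset.sum_congr rfl fun _ _ => by ring
  rw [h]
  ring

lemma cov_add (X : Coord → Coord) {Y Z : Coord → Coord} {x : Coord}
    (hY : DifferentiableAt ℝ Y x) (hZ : DifferentiableAt ℝ Z x) :
    G.cov c X (fun y => Y y + Z y) x = G.cov c X Y x + G.cov c X Z x := by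
  ext μ
  have hY' := differentiableAt_pi.1 hY
  have hZ' := differentiableAt_pi.1 hZ
  simp only [cov, Pi.add_apply, along_add (hY' μ) (hZ' μ), mul_add, Finset.sum_add_distrib]
  ring

lemma cov_sub (X : Coord → Coord) {Y Z : Coord → Coord} {x : Coord}
    (hY : DifferentiableAt ℝ Y x) (hZ : DifferentiableAt ℝ Z x) :
    G.cov c X (fun y => Y y - Z y) x = G.cov c X Y x - G.cov c X Z x := by
  ext μ
  have hY' := differentiableAt_pi.1 hY
  have hZ' := differentiableAt_pi.1 hZ
  simp only [cov, Pi.sub_apply, along_sub (hY' μ) (hZ' μ), mul_sub, Finset.sum_sub_distrib]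
  ring

lemma cov_smul (X : Coord → Coord) {f : Coord → ℝ} {Y : Coord → Coord} {x : Coord}
    (hf : DifferentiableAt ℝ f x) (hY : DifferentiableAt ℝ Y x) :
    G.cov c X (fun y => f y • Y y) x = along X f x • Y x + f x • G.cov c X Y x := by
  ext μ
  have hY' := differentiableAt_pi.1 hY
  simp only [cov, Pi.add_apply, Pi.smul_apply, smul_eq_mul, along_mul hf (hY' μ), mul_add,
    Finset.mul_sum]
  have h : ∑ ν, ∑ κ, G.christoffel c μ ν κ x * X x ν * (f x * Y x κ) =
      ∑ ν, ∑ κ, f x * (G.christoffel c μ ν κ x * X x ν * Y x κ) :=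
    Finset.sum_congr rfl fun _ _ => Finset.sum_congr rfl fun _ _ => by ring
  rw [h]
  ring

end DoubleNull

/-! ### Null pairings, sphere frames and coframes. -/

/-- The angular components `e_aᴬ` of a sphere frame. -/
def frameC (e : Fin 2 → Coord → Coord) (x : Coord) : Matrix (Fin 2) (Fin 2) ℝ :=
  Matrix.of fun a A => e a x (Fin.natAdd 2 A)

namespace DoubleNull

variable {G : DoubleNull} {c : Chart}

variable (G c) in
/-- The components of the coframe dual to a sphere frame `e`. -/
noncomputable def coframeC (e : Fin 2 → Coord → Coord) (x : Coord) : Matrix (Fin 2) (Fin 2) ℝ :=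
  Matrix.of fun b A => ∑ B, G.gammaC c x A B * e b x (Fin.natAdd 2 B)

lemma metric_e3_right {x : Coord} (hx : x ∈ G.coordDom c) (V : Coord) :
    G.metric c x V (G.e3 c x) = -2 * G.lapse c x * V 1 := by
  have h := (lapse_pos hx).ne'
  simp [metric, e3, angForm]
  field_simp

lemma metric_e4_right {x : Coord} (hx : x ∈ G.coordDom c) (V : Coord) :
    G.metric c x V (G.e4 c x) = -2 * G.lapse c x * V 0 := by
  have h := (lapse_pos hx).ne'
  simp [metric, e4, angForm]
  field_simp
  ring

lemma metric_e3_left {x : Coord} (hx : x ∈ G.coordDom c) (V : Coord) :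
    G.metric c x (G.e3 c x) V = -2 * G.lapse c x * V 1 := by
  rw [metric_symm hx, metric_e3_right hx]

lemma metric_e4_left {x : Coord} (hx : x ∈ G.coordDom c) (V : Coord) :
    G.metric c x (G.e4 c x) V = -2 * G.lapse c x * V 0 := by
  rw [metric_symm hx, metric_e4_right hx]

lemma metric_e3_e3 {x : Coord} (hx : x ∈ G.coordDom c) :
    G.metric c x (G.e3 c x) (G.e3 c x) = 0 := by
  rw [metric_e3_right hx]; simp [e3]

lemma metric_e3_e4 {x : Coord} (hx : x ∈ G.coordDom c) :
    G.metric c x (G.e3 c x) (G.e4 c x) = -2 := by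
  have h := (lapse_pos hx).ne'
  rw [metric_e4_right hx]; simp [e3]; field_simp

lemma differentiableAt_e3 (hc : c ∈ IsManifold.maximalAtlas (𝓡 2) ∞ S2) {x : Coord}
    (hx : x ∈ G.coordDom c) : DifferentiableAt ℝ (G.e3 c) x := by
  have h1 := differentiableAt_lapse hc hx
  have h := (lapse_pos hx).ne'
  unfold e3
  exact (h1.inv h).smul (differentiableAt_const _)

lemma differentiableAt_e4 (hc : c ∈ IsManifold.maximalAtlas (𝓡 2) ∞ S2) {x : Coord}
    (hx : x ∈ G.coordDom c) : DifferentiableAt ℝ (G.e4 c) x := by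
  have h1 := differentiableAt_lapse hc hx
  have h := (lapse_pos hx).ne'
  have h3 := differentiableAt_shiftC hc hx
  unfold e4
  refine (h1.inv h).smul (differentiableAt_pi.2 fun i => ?_)
  fin_cases i
  · simp
  · simp
  · simpa using h3 0
  · simpa using h3 1

namespace IsSphereFrame

variable {U : Set Coord} {e : Fin 2 → Coord → Coord} {x : Coord}

/-- Only the `ū`-component of `V` has to vanish, to remove the shift; the `u`-component is free
because `e_b` has no `ū`-component. Hence the formula covers brackets with `e₃`. -/
lemma metric_eq_coframeC (he : G.IsSphereFrame c U e) (hxU : x ∈ U) {V : Coord} (hV : V 1 = 0)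
    (b : Fin 2) : G.metric c x V (e b x) = ∑ A, G.coframeC c e x b A * V (Fin.natAdd 2 A) := by
  obtain ⟨h0, h1⟩ := he.tangent b x hxU
  simp [metric, angForm, coframeC, h0, h1, hV, Fin.sum_univ_two]
  ring

lemma frameC_mul_coframeC (he : G.IsSphereFrame c U e) (hxU : x ∈ U) :
    frameC e x * (G.coframeC c e x).transpose = 1 := by
  ext a b
  have h := he.orthonormal a b x hxU
  rw [he.metric_eq_coframeC hxU (he.tangent a x hxU).2] at h
  rw [Matrix.mul_apply, Matrix.one_apply, ← h]
  exact Finset.sum_congr rfl fun _ _ => by simp [frameC]; ring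

/-- Orthonormality gives a one-sided inverse; for square matrices it is two-sided, which is
completeness of the frame. -/
lemma coframeC_mul_frameC (he : G.IsSphereFrame c U e) (hxU : x ∈ U) (A B : Fin 2) :
    ∑ b, G.coframeC c e x b A * e b x (Fin.natAdd 2 B) = if A = B then 1 else 0 := by
  have h0 := _root_.mul_eq_one_comm.1 (he.frameC_mul_coframeC hxU)
  have h := congrArg (fun M : Matrix (Fin 2) (Fin 2) ℝ => M A B) h0
  simpa [Matrix.mul_apply, frameC, Matrix.one_apply] using h

lemma expand (he : G.IsSphereFrame c U e) (hxU : x ∈ U) {V : Coord} (hV : V 1 = 0) (A : Fin 2) :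
    V (Fin.natAdd 2 A) = ∑ b, G.metric c x V (e b x) * e b x (Fin.natAdd 2 A) := by
  simp only [he.metric_eq_coframeC hxU hV, Finset.sum_mul]
  rw [Finset.sum_comm]
  have : ∀ B, ∑ b, G.coframeC c e x b B * V (Fin.natAdd 2 B) * e b x (Fin.natAdd 2 A) =
      V (Fin.natAdd 2 B) * if B = A then 1 else 0 := by
    intro B
    rw [← he.coframeC_mul_frameC hxU B A, Finset.mul_sum]
    exact Finset.sum_congr rfl fun _ _ => by ring
  simp only [this, mul_ite, mul_one, mul_zero, Finset.sum_ite_eq', Finset.mem_univ, if_true]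

/-- A vector in the kernel is orthogonal to `e₃` and `e₄`, hence has no `ū`- or `u`-component; being
orthogonal to the frame as well, it has no angular part by `expand`. -/
lemma isUnit_det (he : G.IsSphereFrame c U e) (hUdom : U ⊆ G.coordDom c) (hxU : x ∈ U) :
    IsUnit (G.metricC c x).det := by
  have hx := hUdom hxU
  have hΩ := (lapse_pos hx).ne'
  rw [isUnit_iff_ne_zero]
  intro h
  obtain ⟨v, hv, hv0⟩ := Matrix.exists_mulVec_eq_zero_iff.2 h
  have key : ∀ W, G.metric c x W v = 0 := by
    intro W
    rw [metric_eq_sum]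
    refine Finset.sum_eq_zero fun μ _ => ?_
    have := congrFun hv0 μ
    simp only [Matrix.mulVec, dotProduct, Pi.zero_apply] at this
    calc _ = W μ * ∑ ν, G.metricC c x μ ν * v ν := by
          rw [Finset.mul_sum]; exact Finset.sum_congr rfl fun _ _ => by ring
      _ = 0 := by rw [this, mul_zero]
  have h1 : v 1 = 0 := by
    have := key (G.e3 c x); rw [metric_e3_left hx] at this; simpa [hΩ] using this
  have h0 : v 0 = 0 := by
    have := key (G.e4 c x); rw [metric_e4_left hx] at this; simpa [hΩ] using this
  have hA : ∀ A : Fin 2, v (Fin.natAdd 2 A) = 0 := by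
    intro A
    rw [he.expand hxU h1]
    simp [metric_symm hx v, key]
  apply hv
  ext i
  fin_cases i
  · exact h0
  · exact h1
  · exact hA 0
  · exact hA 1

lemma differentiableAt (he : G.IsSphereFrame c U e) (hU : IsOpen U) (hxU : x ∈ U) (a : Fin 2) :
    DifferentiableAt ℝ (e a) x :=
  ((he.contDiffOn a).contDiffAt (hU.mem_nhds hxU)).differentiableAt (by simp)

lemma differentiableAt_apply (he : G.IsSphereFrame c U e) (hU : IsOpen U) (hxU : x ∈ U)
    (a : Fin 2) (μ : Fin 4) : DifferentiableAt ℝ (fun y => e a y μ) x :=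
  differentiableAt_pi.1 (he.differentiableAt hU hxU a) μ

lemma along_apply_zero (he : G.IsSphereFrame c U e) (hU : IsOpen U) (hxU : x ∈ U) (a : Fin 2)
    (X : Coord → Coord) : along X (fun y => e a y 0) x = 0 := by
  rw [along_congr (g := fun _ => 0), along_const]
  filter_upwards [hU.mem_nhds hxU] with y hy using (he.tangent a y hy).1

lemma along_apply_one (he : G.IsSphereFrame c U e) (hU : IsOpen U) (hxU : x ∈ U) (a : Fin 2)
    (X : Coord → Coord) : along X (fun y => e a y 1) x = 0 := by
  rw [along_congr (g := fun _ => 0), along_const]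
  filter_upwards [hU.mem_nhds hxU] with y hy using (he.tangent a y hy).2

end IsSphereFrame

/-! ### Ricci coefficients of the null frame. -/

lemma along_e3_apply_angular (X : Coord → Coord) (x : Coord) (A : Fin 2) :
    along X (fun y => G.e3 c y (Fin.natAdd 2 A)) x = 0 := by
  have : ∀ y, G.e3 c y (Fin.natAdd 2 A) = 0 := by
    intro y; fin_cases A <;> simp [e3]
  simp only [this, along_const]

lemma along_e3_apply_one (X : Coord → Coord) (x : Coord) :
    along X (fun y => G.e3 c y 1) x = 0 := by
  simp [e3, along_const]

lemma along_lapse_inv (hc : c ∈ IsManifold.maximalAtlas (𝓡 2) ∞ S2) {x : Coord}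
    (hx : x ∈ G.coordDom c) (X : Coord → Coord) :
    along X (fun y => (G.lapse c y)⁻¹) x = -(along X (G.lapse c) x) / G.lapse c x ^ 2 := by
  have h1 := differentiableAt_lapse hc hx
  have h := (lapse_pos hx).ne'
  unfold along
  have h2 := ((hasDerivAt_inv h).comp_hasFDerivAt x h1.hasFDerivAt).fderiv
  have h3 : (fun y => (G.lapse c y)⁻¹) = Inv.inv ∘ G.lapse c := rfl
  rw [h3, h2]
  simp
  field_simp

section

variable (hc : c ∈ IsManifold.maximalAtlas (𝓡 2) ∞ S2) {U : Set Coord} (hU : IsOpen U)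
  (hUdom : U ⊆ G.coordDom c) {e : Fin 2 → Coord → Coord} (he : G.IsSphereFrame c U e)
  {x : Coord} (hxU : x ∈ U)

include hc hU hUdom he hxU

/-- If `g(Y, Z)` is constant then `g(D_X Y, Z) = -g(D_X Z, Y)`. -/
lemma metric_cov_of_const (X : Coord → Coord) {Y Z : Coord → Coord}
    (hY : DifferentiableAt ℝ Y x) (hZ : DifferentiableAt ℝ Z x) {r : ℝ}
    (h : ∀ y ∈ U, G.metric c y (Y y) (Z y) = r) :
    G.metric c x (G.cov c X Y x) (Z x) = -G.metric c x (G.cov c X Z x) (Y x) := by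
  have h1 := along_metric hc (hUdom hxU) (he.isUnit_det hUdom hxU) X hY hZ
  rw [along_congr (g := fun _ => r), along_const, metric_symm (hUdom hxU) (Y x)] at h1
  · linarith
  · filter_upwards [hU.mem_nhds hxU] with y hy using h y hy

lemma metric_cov_frame_frame (X : Coord → Coord) (a b : Fin 2) :
    G.metric c x (G.cov c X (e a) x) (e b x) = -G.metric c x (G.cov c X (e b) x) (e a x) :=
  metric_cov_of_const hc hU hUdom he hxU X (he.differentiableAt hU hxU a)
    (he.differentiableAt hU hxU b) fun y hy => he.orthonormal a b y hy

lemma metric_cov_frame_e3 (X : Coord → Coord) (a : Fin 2) :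
    G.metric c x (G.cov c X (e a) x) (G.e3 c x) = -G.metric c x (G.cov c X (G.e3 c) x) (e a x) :=
  metric_cov_of_const hc hU hUdom he hxU X (he.differentiableAt hU hxU a)
    (differentiableAt_e3 hc (hUdom hxU)) (r := 0) fun y hy => by
      rw [metric_e3_right (hUdom hy), (he.tangent a y hy).2, mul_zero]

lemma metric_cov_frame_e4 (X : Coord → Coord) (a : Fin 2) :
    G.metric c x (G.cov c X (e a) x) (G.e4 c x) = -G.metric c x (G.cov c X (G.e4 c) x) (e a x) :=
  metric_cov_of_const hc hU hUdom he hxU X (he.differentiableAt hU hxU a)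
    (differentiableAt_e4 hc (hUdom hxU)) (r := 0) fun y hy => by
      rw [metric_e4_right (hUdom hy), (he.tangent a y hy).1, mul_zero]

lemma metric_cov_e3_e3 (X : Coord → Coord) :
    G.metric c x (G.cov c X (G.e3 c) x) (G.e3 c x) = 0 := by
  have := metric_cov_of_const hc hU hUdom he hxU X (differentiableAt_e3 hc (hUdom hxU))
    (differentiableAt_e3 hc (hUdom hxU)) (r := 0) fun _ hy => metric_e3_e3 (hUdom hy)
  linarith

lemma metric_cov_e3_e4 (X : Coord → Coord) :
    G.metric c x (G.cov c X (G.e3 c) x) (G.e4 c x) =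
      -G.metric c x (G.cov c X (G.e4 c) x) (G.e3 c x) :=
  metric_cov_of_const hc hU hUdom he hxU X (differentiableAt_e3 hc (hUdom hxU))
    (differentiableAt_e4 hc (hUdom hxU)) (r := -2) fun _ hy => metric_e3_e4 (hUdom hy)

-- Both fields are tangent to the incoming cones, hence so is their bracket.
omit hc hUdom in
lemma bracket_e3_frame_one (a : Fin 2) : bracket (G.e3 c) (e a) x 1 = 0 := by
  simp only [bracket, he.along_apply_one hU hxU, along_e3_apply_one, sub_zero]

/-- The generators of the incoming cones are geodesics: `D_{e₃} e₃` has no angular part. -/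
lemma metric_cov_e3_e3_frame (a : Fin 2) :
    G.metric c x (G.cov c (G.e3 c) (G.e3 c) x) (e a x) = 0 := by
  have h1 := metric_cov_frame_e3 hc hU hUdom he hxU (G.e3 c) a
  -- Both `D_{e_a} e₃` and `[e₃, e_a]` are orthogonal to `e₃`: the first because `e₃` is null, the
  -- second because it is tangent to the cone.
  rw [cov_eq_cov_add_bracket (hUdom hxU) (G.e3 c) (e a), metric_add_left,
    metric_cov_e3_e3 hc hU hUdom he hxU, metric_e3_right (hUdom hxU),
    bracket_e3_frame_one hU he hxU] at h1
  linarith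

/-- `g(D_a e₄, e₃) = 2 (η_a - e_a log Ω)`. -/
lemma metric_cov_frame_e4_e3 (a : Fin 2) :
    G.metric c x (G.cov c (e a) (G.e4 c) x) (G.e3 c x) =
      2 * G.eta c e a x - 2 * along (e a) (G.lapse c) x / G.lapse c x := by
  have hΩ := (lapse_pos (hUdom hxU)).ne'
  -- Since `e_a` has no `u`-component, only `-e_a(Ω⁻¹)` is left.
  have h0 : bracket (G.e3 c) (e a) x 0 = along (e a) (G.lapse c) x / G.lapse c x ^ 2 := by
    have h3 : (fun y => G.e3 c y 0) = fun y => (G.lapse c y)⁻¹ := by ext; simp [e3]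
    simp only [bracket, he.along_apply_zero hU hxU, h3, along_lapse_inv hc (hUdom hxU)]
    ring
  have h1 := metric_cov_e3_e4 hc hU hUdom he hxU (e a)
  unfold eta
  rw [cov_eq_cov_add_bracket (hUdom hxU) (G.e3 c) (e a), metric_add_left, h1,
    metric_e4_right (hUdom hxU), h0]
  field_simp
  ring

/-- `g(D_{e₃} e₄, e_a) = 2 η_a`. -/
lemma metric_cov_e3_e4_frame (a : Fin 2) :
    G.metric c x (G.cov c (G.e3 c) (G.e4 c) x) (e a x) = 2 * G.eta c e a x := by
  have h1 := metric_cov_frame_e4 hc hU hUdom he hxU (G.e3 c) a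
  unfold eta
  linarith

/-- `ω̲ = -½ e₃ log Ω`. -/
lemma along_e3_lapse :
    along (G.e3 c) (G.lapse c) x = -2 * G.lapse c x * G.omegab c x := by
  have hΩ := (lapse_pos (hUdom hxU)).ne'
  have h1 : bracket (G.e3 c) (G.e4 c) x 1 =
      -along (G.e3 c) (G.lapse c) x / G.lapse c x ^ 2 := by
    have h3 : (fun y => G.e4 c y 1) = fun y => (G.lapse c y)⁻¹ := by ext; simp [e4]
    simp only [bracket, along_e3_apply_one, h3, along_lapse_inv hc (hUdom hxU)]
    ring
  unfold omegab
  rw [cov_eq_cov_add_bracket (hUdom hxU) (G.e3 c) (G.e4 c), metric_add_left,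
    metric_cov_e3_e3 hc hU hUdom he hxU, metric_e3_right (hUdom hxU), h1]
  field_simp
  ring

omit hc in
/-- `χ̲_{ab} = g(D_{e₃} e_a, e_b) - g([e₃, e_a], e_b)`. -/
lemma chib_eq (a b : Fin 2) : G.chib c e a b x =
    G.metric c x (G.cov c (G.e3 c) (e a) x) (e b x) -
      ∑ A, G.coframeC c e x b A * along (G.e3 c) (fun y => e a y (Fin.natAdd 2 A)) x := by
  have h1 := he.metric_eq_coframeC hxU (bracket_e3_frame_one (G := G) (c := c) hU he hxU a) b
  have h2 : ∀ A : Fin 2, bracket (G.e3 c) (e a) x (Fin.natAdd 2 A) =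
      along (G.e3 c) (fun y => e a y (Fin.natAdd 2 A)) x := fun A => by
    simp only [bracket, along_e3_apply_angular, sub_zero]
  simp only [h2] at h1
  rw [← h1, cov_eq_cov_add_bracket (hUdom hxU) (G.e3 c) (e a), metric_add_left, chib]
  ring

/-- `∑_b g(D_b e_b, e_a) = -div e_a`, in coordinates. -/
lemma sum_metric_cov_frame (a : Fin 2) :
    ∑ b, G.metric c x (G.cov c (e b) (e b) x) (e a x) =
      ∑ b, ∑ A, G.coframeC c e x b A * along (e a) (fun y => e b y (Fin.natAdd 2 A)) x -
      ∑ A : Fin 2, fderiv ℝ (fun y => e a y (Fin.natAdd 2 A)) x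
        (Pi.single (Fin.natAdd 2 A) 1) := by
  -- `g(D_b e_b, e_a) = -g(D_b e_a, e_b) = -g([e_b, e_a], e_b)`, because `g(D_a e_b, e_b) = 0`.
  have h1 : ∀ b, G.metric c x (G.cov c (e b) (e b) x) (e a x) =
      ∑ A, G.coframeC c e x b A * (along (e a) (fun y => e b y (Fin.natAdd 2 A)) x -
        along (e b) (fun y => e a y (Fin.natAdd 2 A)) x) := by
    intro b
    have hb := metric_cov_frame_frame hc hU hUdom he hxU (e a) b b
    have hbr : bracket (e b) (e a) x 1 = 0 := by
      simp only [bracket, he.along_apply_one hU hxU, sub_zero]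
    rw [metric_cov_frame_frame hc hU hUdom he hxU (e b) b a,
      cov_eq_cov_add_bracket (hUdom hxU) (e b) (e a), metric_add_left,
      he.metric_eq_coframeC hxU hbr]
    have : G.metric c x (G.cov c (e a) (e b) x) (e b x) = 0 := by linarith
    rw [this, zero_add, ← Finset.sum_neg_distrib]
    exact Finset.sum_congr rfl fun A _ => by simp only [bracket]; ring
  have h2 : ∀ (b A : Fin 2), along (e b) (fun y => e a y (Fin.natAdd 2 A)) x =
      ∑ B : Fin 2, e b x (Fin.natAdd 2 B) *
        fderiv ℝ (fun y => e a y (Fin.natAdd 2 A)) x (Pi.single (Fin.natAdd 2 B) 1) := by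
    intro b A
    obtain ⟨h0, h1⟩ := he.tangent b x hxU
    rw [along_eq_sum, Fin.sum_univ_four, Fin.sum_univ_two, h0, h1]
    simp only [zero_mul, zero_add]
    rfl
  simp only [h1, mul_sub, Finset.sum_sub_distrib]
  congr 1
  simp only [h2, Finset.mul_sum]
  rw [Finset.sum_comm]
  refine Finset.sum_congr rfl fun A _ => ?_
  rw [Finset.sum_comm]
  have h3 : ∀ B, ∑ b, G.coframeC c e x b A * (e b x (Fin.natAdd 2 B) *
      fderiv ℝ (fun y => e a y (Fin.natAdd 2 A)) x (Pi.single (Fin.natAdd 2 B) 1)) =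
      (if A = B then 1 else 0) *
        fderiv ℝ (fun y => e a y (Fin.natAdd 2 A)) x (Pi.single (Fin.natAdd 2 B) 1) := by
    intro B
    rw [← he.coframeC_mul_frameC hxU A B, Finset.sum_mul]
    exact Finset.sum_congr rfl fun _ _ => by ring
  simp only [h3, ite_mul, one_mul, zero_mul, Finset.sum_ite_eq, Finset.mem_univ, if_true]

end

end DoubleNull

/-! ### The Laplace–Beltrami operator in an orthonormal frame. -/

/-- The `A`-th partial derivative of a function on the plane. -/
noncomputable def partialDeriv (A : Fin 2) (f : E2 → ℝ) (θ : E2) : ℝ :=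
  fderiv ℝ f θ (EuclideanSpace.single A (1 : ℝ))

lemma partialDeriv_mul {A : Fin 2} {f g : E2 → ℝ} {θ : E2}
    (hf : DifferentiableAt ℝ f θ) (hg : DifferentiableAt ℝ g θ) :
    partialDeriv A (fun y => f y * g y) θ =
      f θ * partialDeriv A g θ + partialDeriv A f θ * g θ := by
  unfold partialDeriv
  rw [fderiv_fun_mul hf hg]
  simp [mul_comm]

lemma partialDeriv_sub {A : Fin 2} {f g : E2 → ℝ} {θ : E2}
    (hf : DifferentiableAt ℝ f θ) (hg : DifferentiableAt ℝ g θ) :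
    partialDeriv A (fun y => f y - g y) θ = partialDeriv A f θ - partialDeriv A g θ := by
  unfold partialDeriv
  rw [fderiv_fun_sub hf hg]
  simp

lemma partialDeriv_sum {ι : Type*} {s : Finset ι} {A : Fin 2} {f : ι → E2 → ℝ} {θ : E2}
    (hf : ∀ i, DifferentiableAt ℝ (f i) θ) :
    partialDeriv A (fun y => ∑ i ∈ s, f i y) θ = ∑ i ∈ s, partialDeriv A (f i) θ := by
  unfold partialDeriv
  rw [fderiv_fun_sum fun i _ => hf i]
  simp

lemma partialDeriv_inv {A : Fin 2} {f : E2 → ℝ} {θ : E2} (hf : DifferentiableAt ℝ f θ)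
    (h : f θ ≠ 0) :
    partialDeriv A (fun y => (f y)⁻¹) θ = -partialDeriv A f θ / f θ ^ 2 := by
  unfold partialDeriv
  have h2 := ((hasDerivAt_inv h).comp_hasFDerivAt θ hf.hasFDerivAt).fderiv
  have h3 : (fun y => (f y)⁻¹) = Inv.inv ∘ f := rfl
  rw [h3, h2]
  simp
  field_simp

/-- In a matrix equation `E h Eᵀ = 1`, the inverse of `h` is `Eᵀ E` and `det h = (det E)⁻²`. -/
lemma inv_and_det_of_frame {E h : Matrix (Fin 2) (Fin 2) ℝ} (H : E * h * E.transpose = 1) :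
    h⁻¹ = E.transpose * E ∧ √h.det = |E.det|⁻¹ ∧ E.det ≠ 0 := by
  have h1 : E.det * h.det * E.det = 1 := by
    have := congrArg Matrix.det H
    simpa [Matrix.det_mul] using this
  have hE : E.det ≠ 0 := by
    rintro h0
    simp [h0] at h1
  refine ⟨?_, ?_, hE⟩
  · apply Matrix.inv_eq_left_inv
    have h2 : h * E.transpose * E = 1 := by
      rw [mul_assoc] at H
      exact _root_.mul_eq_one_comm.1 H
    have h3 := _root_.mul_eq_one_comm.1 ((mul_assoc _ _ _).symm.trans h2)
    exact h3
  · have h2 : h.det = (|E.det|⁻¹) ^ 2 := by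
      rw [inv_pow, sq_abs]
      field_simp
      linarith
    rw [h2, Real.sqrt_sq (by positivity)]

/-- The Laplace–Beltrami operator in terms of an orthonormal frame `E` with dual coframe `F`. -/
lemma laplaceBeltrami_eq_of_frame {h E : E2 → Matrix (Fin 2) (Fin 2) ℝ} {f : E2 → ℝ} {θ : E2}
    {F : Matrix (Fin 2) (Fin 2) ℝ}
    (H : ∀ᶠ y in 𝓝 θ, E y * h y * (E y).transpose = 1) (hF : E θ * F.transpose = 1)
    (hE : ∀ a A, DifferentiableAt ℝ (fun y => E y a A) θ)
    (hf : ∀ A, DifferentiableAt ℝ (partialDeriv A f) θ) :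
    laplaceBeltrami h f θ = ∑ a, (∑ A, E θ a A *
        partialDeriv A (fun y => ∑ B, E y a B * partialDeriv B f y) θ +
      (∑ A, partialDeriv A (fun y => E y a A) θ -
        ∑ C, E θ a C * ∑ b, ∑ A, F b A * partialDeriv C (fun y => E y b A) θ) *
        ∑ B, E θ a B * partialDeriv B f θ) := by
  obtain ⟨-, hdet0, hD⟩ := inv_and_det_of_frame H.self_of_nhds
  have hdet2 : ∀ y, (E y).det = E y 0 0 * E y 1 1 - E y 0 1 * E y 1 0 := fun y =>
    Matrix.det_fin_two _
  have hDd : DifferentiableAt ℝ (fun y => (E y).det) θ := by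
    simp only [hdet2]
    fun_prop
  -- The sign of `det E` is locally constant, so the absolute value in `√det h` can be replaced by a
  -- constant factor before differentiating.
  obtain ⟨s, hs, hsD⟩ : ∃ s : ℝ, s * s = 1 ∧ ∀ᶠ y in 𝓝 θ, |(E y).det|⁻¹ = s * ((E y).det)⁻¹ := by
    rcases lt_or_gt_of_ne hD with h0 | h0
    · refine ⟨-1, by norm_num, ?_⟩
      filter_upwards [hDd.continuousAt.eventually_lt continuousAt_const h0] with y hy
      rw [abs_of_neg hy, inv_neg]; ring
    · refine ⟨1, by norm_num, ?_⟩
      filter_upwards [continuousAt_const.eventually_lt hDd.continuousAt h0] with y hy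
      rw [abs_of_pos hy, one_mul]
  have hDi : DifferentiableAt ℝ (fun y => ((E y).det)⁻¹) θ := hDd.inv hD
  have key : ∀ A B, partialDeriv A (fun y => √(h y).det * (h y)⁻¹ A B * partialDeriv B f y) θ =
      partialDeriv A (fun y => s * (((E y).det)⁻¹ * ∑ a, E y a A * (E y a B * partialDeriv B f y)))
        θ := by
    intro A B
    unfold partialDeriv
    refine congrArg (fun L : E2 →L[ℝ] ℝ => L _) (Filter.EventuallyEq.fderiv_eq ?_)
    filter_upwards [H, hsD] with y hy hy2
    obtain ⟨h1, h2, -⟩ := inv_and_det_of_frame hy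
    rw [h1, h2, hy2, Matrix.mul_apply]
    simp only [Matrix.transpose_apply, Fin.sum_univ_two]
    ring
  have hinv : ∀ A b, F b A = ((E θ).det)⁻¹ * (E θ).adjugate A b := by
    intro A b
    have h1 : (E θ)⁻¹ = F.transpose := Matrix.inv_eq_right_inv hF
    rw [← Matrix.transpose_apply F, ← h1, Matrix.inv_def, Ring.inverse_eq_inv']
    rfl
  -- Jacobi's formula, with `Fᵀ = E⁻¹`.
  have hdiffdet : ∀ C, partialDeriv C (fun y => (E y).det) θ =
      (E θ).det * ∑ b, ∑ A, F b A * partialDeriv C (fun y => E y b A) θ := by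
    intro C
    simp only [hinv, hdet2]
    rw [← hdet2, partialDeriv_sub (by fun_prop) (by fun_prop),
      partialDeriv_mul (by fun_prop) (by fun_prop), partialDeriv_mul (by fun_prop) (by fun_prop)]
    simp only [Matrix.adjugate_fin_two, Fin.sum_univ_two, Matrix.of_apply, Matrix.cons_val_zero,
      Matrix.cons_val_one]
    field_simp
    ring
  have hterm : ∀ A B, partialDeriv A
      (fun y => s * (((E y).det)⁻¹ * ∑ a, E y a A * (E y a B * partialDeriv B f y))) θ =
      s * ((E θ).det)⁻¹ * ∑ a, (E θ a A * partialDeriv A (fun y => E y a B * partialDeriv B f y) θ +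
        (partialDeriv A (fun y => E y a A) θ -
          E θ a A * ∑ b, ∑ C, F b C * partialDeriv A (fun y => E y b C) θ) *
          (E θ a B * partialDeriv B f θ)) := by
    intro A B
    rw [partialDeriv_mul (by fun_prop) (by fun_prop), partialDeriv_mul hDi (by fun_prop),
      partialDeriv_inv hDd hD, hdiffdet, partialDeriv_sum (fun a => by fun_prop)]
    have hc : partialDeriv A (fun _ : E2 => s) θ = 0 := by simp [partialDeriv]
    rw [hc]
    have h2 : ∀ a, partialDeriv A (fun y => E y a A * (E y a B * partialDeriv B f y)) θ =
        E θ a A * partialDeriv A (fun y => E y a B * partialDeriv B f y) θ +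
        partialDeriv A (fun y => E y a A) θ * (E θ a B * partialDeriv B f θ) := fun a =>
      partialDeriv_mul (by fun_prop) (by fun_prop)
    simp only [h2, Fin.sum_univ_two (f := fun a => _ + _),
      Fin.sum_univ_two (f := fun a => E θ a A * _)]
    field_simp
    ring
  have hsum : ∀ a A, partialDeriv A (fun y => ∑ B, E y a B * partialDeriv B f y) θ =
      ∑ B, partialDeriv A (fun y => E y a B * partialDeriv B f y) θ := fun a A =>
    partialDeriv_sum (fun B => by fun_prop)
  have hpre : (√(h θ).det)⁻¹ * (s * ((E θ).det)⁻¹) = 1 := by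
    rw [hdet0, ← hsD.self_of_nhds]
    exact inv_mul_cancel₀ (by positivity)
  have hLB : laplaceBeltrami h f θ = (√(h θ).det)⁻¹ * ∑ A, ∑ B,
      partialDeriv A (fun y => √(h y).det * (h y)⁻¹ A B * partialDeriv B f y) θ := rfl
  rw [hLB]
  simp only [key, hterm, ← Finset.mul_sum]
  rw [← mul_assoc, hpre, one_mul]
  simp only [hsum, Finset.sum_add_distrib, Finset.mul_sum, Finset.sum_mul, Finset.sum_sub_distrib,
    sub_mul]
  simp only [Fin.sum_univ_two]
  ring

/-! ### Functions of `ω` and sections of the cone, in coordinates. -/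

lemma contDiffOn_comp_chart_symm {c : Chart} (hc : c ∈ IsManifold.maximalAtlas (𝓡 2) ∞ S2)
    {R : S2 → ℝ} (hR : ContMDiff (𝓡 2) 𝓘(ℝ, ℝ) 2 R) :
    ContDiffOn ℝ 2 (fun θ => R (c.symm θ)) c.target := by
  rw [← contMDiffOn_iff_contDiffOn]
  have h1 : ContMDiffOn (𝓡 2) (𝓡 2) 2 c.symm c.target :=
    (contMDiffOn_symm_of_mem_maximalAtlas hc).of_le (by norm_cast)
  exact hR.comp_contMDiffOn h1

lemma differentiableAt_comp_chart_symm {c : Chart}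
    (hc : c ∈ IsManifold.maximalAtlas (𝓡 2) ∞ S2)
    {R : S2 → ℝ} (hR : ContMDiff (𝓡 2) 𝓘(ℝ, ℝ) 2 R) {θ : E2} (hθ : θ ∈ c.target) :
    DifferentiableAt ℝ (fun θ => R (c.symm θ)) θ :=
  ((contDiffOn_comp_chart_symm hc hR).contDiffAt
    (c.open_target.mem_nhds hθ)).differentiableAt (by norm_num)

lemma differentiableAt_partialDeriv_comp_chart_symm {c : Chart}
    (hc : c ∈ IsManifold.maximalAtlas (𝓡 2) ∞ S2)
    {R : S2 → ℝ} (hR : ContMDiff (𝓡 2) 𝓘(ℝ, ℝ) 2 R) {θ : E2} (hθ : θ ∈ c.target) (A : Fin 2) :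
    DifferentiableAt ℝ (partialDeriv A fun θ => R (c.symm θ)) θ := by
  have h1 := (contDiffOn_comp_chart_symm hc hR).contDiffAt (c.open_target.mem_nhds hθ)
  have h2 : DifferentiableAt ℝ (fderiv ℝ fun θ => R (c.symm θ)) θ :=
    (h1.fderiv_right (m := 1) (by norm_num)).differentiableAt (by norm_num)
  unfold partialDeriv
  fun_prop

lemma hasFDerivAt_ang (x : Coord) : ∃ L : Coord →L[ℝ] E2, HasFDerivAt ang L x ∧
    ∀ V, L V = ∑ B : Fin 2, V (Fin.natAdd 2 B) • EuclideanSpace.single B (1 : ℝ) := by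
  let L : Coord →ₗ[ℝ] E2 :=
    { toFun := ang
      map_add' := fun x y => by ext i; fin_cases i <;> simp [ang]
      map_smul' := fun r y => by ext i; fin_cases i <;> simp [ang] }
  refine ⟨L.toContinuousLinearMap, L.toContinuousLinearMap.hasFDerivAt, fun V => ?_⟩
  change ang V = _
  ext i
  fin_cases i <;> simp [ang, Fin.sum_univ_two]

lemma ang_pt (u ub : ℝ) (θ : E2) : ang (pt u ub θ) = θ := by
  ext i
  fin_cases i <;> simp [ang, pt]

lemma along_onSpacetime {c : Chart} {R : S2 → ℝ} {x : Coord}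
    (hf : DifferentiableAt ℝ (fun θ => R (c.symm θ)) (ang x)) (X : Coord → Coord) :
    along X (onSpacetime c R) x = ∑ B : Fin 2, X x (Fin.natAdd 2 B) *
      partialDeriv B (fun θ => R (c.symm θ)) (ang x) := by
  obtain ⟨L, hL, hLV⟩ := hasFDerivAt_ang x
  have h := (hf.hasFDerivAt.comp x hL).fderiv
  have h2 : onSpacetime c R = (fun θ => R (c.symm θ)) ∘ ang := rfl
  unfold along partialDeriv
  rw [h2, h, ContinuousLinearMap.comp_apply, hLV]
  simp only [map_sum, map_smul, smul_eq_mul]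

/-- The coordinate vectors of the surface `u = w(θ)` on an incoming cone. -/
lemma hasFDerivAt_pt {w : E2 → ℝ} {θ : E2} (hw : DifferentiableAt ℝ w θ) (ub : ℝ) :
    ∃ L : E2 →L[ℝ] Coord, HasFDerivAt (fun y => pt (w y) ub y) L θ ∧
      ∀ A : Fin 2, L (EuclideanSpace.single A (1 : ℝ)) =
        Pi.single (Fin.natAdd 2 A) 1 + partialDeriv A w θ • (Pi.single 0 1 : Coord) := by
  let p : Fin 2 → E2 →L[ℝ] ℝ := fun A => EuclideanSpace.proj A
  refine ⟨ContinuousLinearMap.pi ![fderiv ℝ w θ, 0, p 0, p 1], hasFDerivAt_pi.2 fun i => ?_,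
    fun A => ?_⟩
  · fin_cases i
    · exact hw.hasFDerivAt
    · exact hasFDerivAt_const _ _
    · exact (p 0).hasFDerivAt
    · exact (p 1).hasFDerivAt
  · ext i
    fin_cases i <;> fin_cases A <;> simp [p, partialDeriv]

lemma partialDeriv_comp_pt {w : E2 → ℝ} {θ : E2} (hw : DifferentiableAt ℝ w θ) (ub : ℝ)
    {g : Coord → ℝ} (hg : DifferentiableAt ℝ g (pt (w θ) ub θ)) (A : Fin 2) :
    partialDeriv A (fun y => g (pt (w y) ub y)) θ =
      fderiv ℝ g (pt (w θ) ub θ) (Pi.single (Fin.natAdd 2 A) 1) +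
        partialDeriv A w θ * fderiv ℝ g (pt (w θ) ub θ) (Pi.single 0 1) := by
  obtain ⟨L, hL, hLA⟩ := hasFDerivAt_pt hw ub
  have h := (HasFDerivAt.comp θ (f := fun y => pt (w y) ub y) hg.hasFDerivAt hL).fderiv
  have h2 : (fun y => g (pt (w y) ub y)) = g ∘ fun y => pt (w y) ub y := rfl
  unfold partialDeriv at hLA ⊢
  rw [h2, h, ContinuousLinearMap.comp_apply, hLA, map_add, map_smul, smul_eq_mul]

/-! ### The Laplacian of a section of an incoming cone. -/

namespace DoubleNull

variable {G : DoubleNull} {c : Chart}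

lemma fderiv_single_zero {x : Coord} (hx : x ∈ G.coordDom c) (g : Coord → ℝ) :
    fderiv ℝ g x (Pi.single 0 1) = G.lapse c x * along (G.e3 c) g x := by
  have hΩ := (lapse_pos hx).ne'
  have h : (![1, 0, 0, 0] : Coord) = Pi.single 0 1 := by
    ext i; fin_cases i <;> simp
  simp only [along, e3, h, map_smul, smul_eq_mul]
  field_simp

/-- The surface has `dū = 0`, and `du` enters `g` only through its product with `dū`. -/
lemma inducedMetric_pt {w : E2 → ℝ} {θ : E2} (hw : DifferentiableAt ℝ w θ) (ub : ℝ) :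
    G.inducedMetric c (fun y => pt (w y) ub y) θ =
      Matrix.of fun A B => G.gammaC c (pt (w θ) ub θ) A B := by
  obtain ⟨L, hL, hLA⟩ := hasFDerivAt_pt hw ub
  ext A B
  simp only [inducedMetric, Matrix.of_apply, hL.fderiv, hLA]
  fin_cases A <;> fin_cases B <;>
    simp [metric, angForm, Fin.sum_univ_two, Pi.single_apply]

lemma IsSphereFrame.frameC_mul_gammaC_mul_transpose {U : Set Coord}
    {e : Fin 2 → Coord → Coord} {x : Coord} (he : G.IsSphereFrame c U e) (hxU : x ∈ U) :
    frameC e x * (Matrix.of fun A B => G.gammaC c x A B) * (frameC e x).transpose = 1 := by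
  rw [← he.frameC_mul_coframeC hxU, mul_assoc]
  congr 1

section

variable (hc : c ∈ IsManifold.maximalAtlas (𝓡 2) ∞ S2) {U : Set Coord} (hU : IsOpen U)
  (hUdom : U ⊆ G.coordDom c) {e : Fin 2 → Coord → Coord} (he : G.IsSphereFrame c U e)
  {R : S2 → ℝ} (hR : ContMDiff (𝓡 2) 𝓘(ℝ, ℝ) 2 R)

include hc hU hUdom he hR

omit hU he in
lemma along_frame_onSpacetime {x : Coord} (hxU : x ∈ U) (a : Fin 2) :
    along (e a) (onSpacetime c R) x = ∑ B : Fin 2, e a x (Fin.natAdd 2 B) *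
      partialDeriv B (fun θ => R (c.symm θ)) (ang x) :=
  along_onSpacetime (differentiableAt_comp_chart_symm hc hR (hUdom hxU).2) _

/-- `e_a R = e_aᴬ ∂_A R` is a sum of products of `C¹` functions, as `e` is `C¹` and `R` is `C²`. -/
lemma differentiableAt_along_frame_onSpacetime {x : Coord} (hxU : x ∈ U) (a : Fin 2) :
    DifferentiableAt ℝ (along (e a) (onSpacetime c R)) x := by
  have h : along (e a) (onSpacetime c R) =ᶠ[𝓝 x] fun y => ∑ B : Fin 2, e a y (Fin.natAdd 2 B) *
      partialDeriv B (fun θ => R (c.symm θ)) (ang y) := by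
    filter_upwards [hU.mem_nhds hxU] with y hy
      using along_frame_onSpacetime hc hUdom hR hy a
  refine DifferentiableAt.congr_of_eventuallyEq ?_ h
  have h1 : ∀ B, DifferentiableAt ℝ
      (fun y => partialDeriv B (fun θ => R (c.symm θ)) (ang y)) x := fun B =>
    (differentiableAt_partialDeriv_comp_chart_symm hc hR (hUdom hxU).2 B).comp x
      ((contDiff_ang (n := 1)).differentiable (by norm_num) x)
  have h2 := he.differentiableAt_apply hU hxU
  fun_prop

/-- `e₃(e_a R) = e₃(e_aᴬ) ∂_A R`, since `R` does not depend on `u`. -/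
lemma along_e3_along_frame_onSpacetime {x : Coord} (hxU : x ∈ U) (a : Fin 2) :
    along (G.e3 c) (along (e a) (onSpacetime c R)) x =
      ∑ B : Fin 2, along (G.e3 c) (fun y => e a y (Fin.natAdd 2 B)) x *
        partialDeriv B (fun θ => R (c.symm θ)) (ang x) := by
  rw [along_congr (g := fun y => ∑ B : Fin 2, e a y (Fin.natAdd 2 B) *
      partialDeriv B (fun θ => R (c.symm θ)) (ang y))]
  swap
  · filter_upwards [hU.mem_nhds hxU] with y hy
      using along_frame_onSpacetime hc hUdom hR hy a
  obtain ⟨L, hL, hLV⟩ := hasFDerivAt_ang x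
  have h1 : ∀ B, HasFDerivAt (fun y => partialDeriv B (fun θ => R (c.symm θ)) (ang y))
      ((fderiv ℝ (partialDeriv B fun θ => R (c.symm θ)) (ang x)).comp L) x := fun B =>
    (differentiableAt_partialDeriv_comp_chart_symm hc hR
      (hUdom hxU).2 B).hasFDerivAt.comp x hL
  have h1d := fun B => (h1 B).differentiableAt
  have h2 := he.differentiableAt_apply hU hxU
  have h3 : ∀ B, along (G.e3 c)
      (fun y => partialDeriv B (fun θ => R (c.symm θ)) (ang y)) x = 0 := by
    intro B
    unfold along
    rw [(h1 B).fderiv, ContinuousLinearMap.comp_apply, hLV]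
    simp [Fin.sum_univ_two, e3]
  rw [along_sum (fun B => by fun_prop)]
  refine Finset.sum_congr rfl fun B _ => ?_
  rw [along_mul (h2 _ _) (h1d B), h3, mul_zero, zero_add]

/-- The Laplace–Beltrami operator of the surface `u = w(θ)` on an incoming cone, where
`∂_A w = -s ∂_A R` at the point considered. -/
lemma laplaceBeltrami_inducedMetric_pt {w : E2 → ℝ} {θ : E2} {ub s : ℝ}
    (hw : ∀ᶠ y in 𝓝 θ, DifferentiableAt ℝ w y)
    (hwR : ∀ A, partialDeriv A w θ = -s * partialDeriv A (fun θ => R (c.symm θ)) θ)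
    (hp : pt (w θ) ub θ ∈ U) :
    laplaceBeltrami (G.inducedMetric c fun y => pt (w y) ub y) (fun θ => R (c.symm θ)) θ =
      G.frameLaplacian c e (onSpacetime c R) (pt (w θ) ub θ) +
      s * G.lapse c (pt (w θ) ub θ) * ∑ a, along (e a) (onSpacetime c R) (pt (w θ) ub θ) *
        (along (e a) (onSpacetime c R) (pt (w θ) ub θ) *
          ∑ b, ∑ A, G.coframeC c e (pt (w θ) ub θ) b A *
            along (G.e3 c) (fun y => e b y (Fin.natAdd 2 A)) (pt (w θ) ub θ) -
          2 * ∑ A : Fin 2, along (G.e3 c) (fun y => e a y (Fin.natAdd 2 A)) (pt (w θ) ub θ) *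
            partialDeriv A (fun θ => R (c.symm θ)) θ) := by
  set p := pt (w θ) ub θ with hpdef
  have hx := hUdom hp
  have hwθ := hw.self_of_nhds
  have hcont : ContinuousAt (fun y => pt (w y) ub y) θ :=
    (hasFDerivAt_pt hwθ ub).choose_spec.1.continuousAt
  have hFU : ∀ᶠ y in 𝓝 θ, pt (w y) ub y ∈ U := hcont.eventually (hU.mem_nhds hp)
  have hθ : θ ∈ c.target := by simpa [hpdef, ang_pt] using hx.2
  have hed := he.differentiableAt_apply hU hp
  have hEdiff : ∀ a A, DifferentiableAt ℝ (fun y => frameC e (pt (w y) ub y) a A) θ := fun a A =>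
    DifferentiableAt.comp θ (f := fun y => pt (w y) ub y) (hed a (Fin.natAdd 2 A))
      (hasFDerivAt_pt hwθ ub).choose_spec.1.differentiableAt
  have hLB := laplaceBeltrami_eq_of_frame
    (h := G.inducedMetric c fun y => pt (w y) ub y) (E := fun y => frameC e (pt (w y) ub y))
    (f := fun θ => R (c.symm θ)) (θ := θ) (F := G.coframeC c e p)
    (by
      filter_upwards [hw, hFU] with y hy hyU
      rw [inducedMetric_pt hy]
      exact he.frameC_mul_gammaC_mul_transpose hyU)
    (he.frameC_mul_coframeC hp) hEdiff
    (differentiableAt_partialDeriv_comp_chart_symm hc hR hθ)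
  rw [← hpdef] at hLB
  rw [hLB]
  -- The tangential derivative is `∂_C + (∂_C w) ∂_u`, with `∂_u = Ω e₃` and `∂_C w = -s ∂_C R`.
  have hDE : ∀ C a A, partialDeriv C (fun y => frameC e (pt (w y) ub y) a A) θ =
      fderiv ℝ (fun y => e a y (Fin.natAdd 2 A)) p (Pi.single (Fin.natAdd 2 C) 1) -
        s * partialDeriv C (fun θ => R (c.symm θ)) θ *
          (G.lapse c p * along (G.e3 c) (fun y => e a y (Fin.natAdd 2 A)) p) := by
    intro C a A
    have := partialDeriv_comp_pt hwθ ub (hed a (Fin.natAdd 2 A)) C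
    rw [fderiv_single_zero hx, hwR] at this
    simp only [frameC, Matrix.of_apply, this]
    ring
  have hRa : ∀ a, ∑ B, frameC e p a B * partialDeriv B (fun θ => R (c.symm θ)) θ =
      along (e a) (onSpacetime c R) p := by
    intro a
    rw [along_frame_onSpacetime hc hUdom hR hp, hpdef, ang_pt]
    rfl
  have hDR : ∀ C a, partialDeriv C (fun y => ∑ B, frameC e (pt (w y) ub y) a B *
      partialDeriv B (fun θ => R (c.symm θ)) y) θ =
      fderiv ℝ (along (e a) (onSpacetime c R)) p (Pi.single (Fin.natAdd 2 C) 1) -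
        s * partialDeriv C (fun θ => R (c.symm θ)) θ *
          (G.lapse c p * ∑ A : Fin 2, along (G.e3 c) (fun y => e a y (Fin.natAdd 2 A)) p *
            partialDeriv A (fun θ => R (c.symm θ)) θ) := by
    intro C a
    have h1 : (fun y => ∑ B, frameC e (pt (w y) ub y) a B *
        partialDeriv B (fun θ => R (c.symm θ)) y) =ᶠ[𝓝 θ]
        fun y => along (e a) (onSpacetime c R) (pt (w y) ub y) := by
      filter_upwards [hFU] with y hy
      rw [along_frame_onSpacetime hc hUdom hR hy, ang_pt]
      rfl
    have h2 : partialDeriv C (fun y => ∑ B, frameC e (pt (w y) ub y) a B *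
        partialDeriv B (fun θ => R (c.symm θ)) y) θ =
        partialDeriv C (fun y => along (e a) (onSpacetime c R) (pt (w y) ub y)) θ := by
      unfold partialDeriv at h1 ⊢
      rw [h1.fderiv_eq]
    rw [h2, partialDeriv_comp_pt hwθ ub
      (differentiableAt_along_frame_onSpacetime hc hU hUdom he hR hp a),
      fderiv_single_zero hx, along_e3_along_frame_onSpacetime hc hU hUdom he hR hp, hwR,
      ang_pt]
    ring
  have halong : ∀ a (g : Coord → ℝ), along (e a) g p =
      ∑ C : Fin 2, frameC e p a C * fderiv ℝ g p (Pi.single (Fin.natAdd 2 C) 1) := by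
    intro a g
    obtain ⟨h0, h1⟩ := he.tangent a p hp
    rw [along_eq_sum, Fin.sum_univ_four, Fin.sum_univ_two, h0, h1]
    simp only [zero_mul, zero_add]
    rfl
  -- Exchanging the names of the two frame indices exposes the coefficient of `e_a R` as the
  -- negative divergence computed in `sum_metric_cov_frame`.
  have hfl : G.frameLaplacian c e (onSpacetime c R) p =
      ∑ a, (along (e a) (along (e a) (onSpacetime c R)) p -
        (∑ b, G.metric c p (G.cov c (e b) (e b) p) (e a p)) * along (e a) (onSpacetime c R) p) := by
    unfold frameLaplacian
    simp only [Fin.sum_univ_two]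
    ring
  rw [hfl]
  simp only [sum_metric_cov_frame hc hU hUdom he hp]
  simp only [hDE, hDR, hRa]
  have hR2 : ∀ a, along (e a) (onSpacetime c R) p = frameC e p a 0 *
      partialDeriv 0 (fun θ => R (c.symm θ)) θ + frameC e p a 1 *
      partialDeriv 1 (fun θ => R (c.symm θ)) θ := fun a => by
    rw [← hRa, Fin.sum_univ_two]
  have halong2 : ∀ a, along (e a) (along (e a) (onSpacetime c R)) p =
      frameC e p a 0 * fderiv ℝ (along (e a) (onSpacetime c R)) p
        (Pi.single (Fin.natAdd 2 (0 : Fin 2)) 1) +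
      frameC e p a 1 * fderiv ℝ (along (e a) (onSpacetime c R)) p
        (Pi.single (Fin.natAdd 2 (1 : Fin 2)) 1) := fun a => by
    rw [halong, Fin.sum_univ_two]
  have halong3 : ∀ a b A : Fin 2, along (e a) (fun y => e b y (Fin.natAdd 2 A)) p =
      frameC e p a 0 * fderiv ℝ (fun y => e b y (Fin.natAdd 2 A)) p
        (Pi.single (Fin.natAdd 2 (0 : Fin 2)) 1) +
      frameC e p a 1 * fderiv ℝ (fun y => e b y (Fin.natAdd 2 A)) p
        (Pi.single (Fin.natAdd 2 (1 : Fin 2)) 1) := fun a b A => by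
    rw [halong, Fin.sum_univ_two]
  simp only [halong2, halong3]
  rw [Finset.mul_sum, ← Finset.sum_add_distrib]
  refine Finset.sum_congr rfl fun a _ => ?_
  have hRa' := hR2 a
  generalize along (e a) (onSpacetime c R) p = Ra at hRa' ⊢
  simp only [Fin.sum_univ_two]
  rw [hRa']
  ring

end

end DoubleNull

/-! ### The shear term and the expansion of the deformed sphere. -/

namespace DoubleNull

variable {G : DoubleNull} {c : Chart}

section

variable (hc : c ∈ IsManifold.maximalAtlas (𝓡 2) ∞ S2) {U : Set Coord} (hU : IsOpen U)
  (hUdom : U ⊆ G.coordDom c) {e : Fin 2 → Coord → Coord} (he : G.IsSphereFrame c U e)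
  {R : S2 → ℝ} (hR : ContMDiff (𝓡 2) 𝓘(ℝ, ℝ) 2 R) {x : Coord} (hxU : x ∈ U)

include hc hU hUdom he hR hxU

/-- `χ̲(∇R, ∇R) = -∑ₐ (e_a R) e₃(e_a R)`. -/
lemma sum_chib_mul_along : ∑ a, ∑ b, G.chib c e a b x * along (e a) (onSpacetime c R) x *
      along (e b) (onSpacetime c R) x =
    -∑ a, along (e a) (onSpacetime c R) x *
      along (G.e3 c) (along (e a) (onSpacetime c R)) x := by
  have h1 : ∀ A, ∑ b, G.coframeC c e x b A * along (e b) (onSpacetime c R) x =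
      partialDeriv A (fun θ => R (c.symm θ)) (ang x) := by
    intro A
    simp only [along_frame_onSpacetime hc hUdom hR hxU, Finset.mul_sum]
    rw [Finset.sum_comm]
    have h2 : ∀ B, ∑ b, G.coframeC c e x b A * (e b x (Fin.natAdd 2 B) *
        partialDeriv B (fun θ => R (c.symm θ)) (ang x)) =
        (if A = B then 1 else 0) * partialDeriv B (fun θ => R (c.symm θ)) (ang x) := by
      intro B
      rw [← he.coframeC_mul_frameC hxU A B, Finset.sum_mul]
      exact Finset.sum_congr rfl fun _ _ => by ring
    simp only [h2, ite_mul, one_mul, zero_mul, Finset.sum_ite_eq, Finset.mem_univ, if_true]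
  have h3 := metric_cov_frame_frame hc hU hUdom he hxU (G.e3 c)
  have h00 := h3 0 0
  have h01 := h3 0 1
  have h11 := h3 1 1
  simp only [along_e3_along_frame_onSpacetime hc hU hUdom he hR hxU, ← h1,
    chib_eq hU hUdom he hxU, Fin.sum_univ_two]
  generalize along (e 0) (onSpacetime c R) x = R0
  generalize along (e 1) (onSpacetime c R) x = R1
  -- The antisymmetric `g(D_{e₃} e_a, e_b)` vanishes on the symmetric `R_a R_b`.
  linear_combination (1 / 2 * R0 ^ 2) * h00 + (R0 * R1) * h01 + (1 / 2 * R1 ^ 2) * h11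

/-- The right side is the correction in `laplaceBeltrami_inducedMetric_pt` for `s = 1`: its double
sum over the coframe is `-tr χ̲`, and its last sum is `e₃(e_a R)`. -/
lemma sum_chibHat_mul_along :
    2 * G.lapse c x * ∑ a, ∑ b, G.chibHat c e a b x * along (e a) (onSpacetime c R) x *
      along (e b) (onSpacetime c R) x =
    G.lapse c x * ∑ a, along (e a) (onSpacetime c R) x *
        (along (e a) (onSpacetime c R) x *
          ∑ b, ∑ A, G.coframeC c e x b A *
            along (G.e3 c) (fun y => e b y (Fin.natAdd 2 A)) x -
          2 * ∑ A : Fin 2, along (G.e3 c) (fun y => e a y (Fin.natAdd 2 A)) x *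
            partialDeriv A (fun θ => R (c.symm θ)) (ang x)) := by
  have h1 := sum_chib_mul_along hc hU hUdom he hR hxU
  have h2 : G.trChib c e x = -∑ b, ∑ A, G.coframeC c e x b A *
      along (G.e3 c) (fun y => e b y (Fin.natAdd 2 A)) x := by
    have h3 := metric_cov_frame_frame hc hU hUdom he hxU (G.e3 c)
    have h00 := h3 0 0
    have h11 := h3 1 1
    simp only [trChib, chib_eq hU hUdom he hxU, Finset.sum_sub_distrib]
    rw [Fin.sum_univ_two (f := fun a => G.metric c x _ _)]
    linarith
  simp only [← along_e3_along_frame_onSpacetime hc hU hUdom he hR hxU, chibHat]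
  rw [← neg_eq_iff_eq_neg.2 h2]
  simp only [Fin.sum_univ_two] at h1 ⊢
  simp only [if_true, zero_ne_one, one_ne_zero, if_false]
  linear_combination (2 * G.lapse c x) * h1

/-- The component of `D_X e'₄` along `e'_a`. -/
lemma metric_cov_defE4_defFrame (X : Coord → Coord) (a : Fin 2) :
    G.metric c x (G.cov c X (G.defE4 c e (onSpacetime c R)) x)
        (G.defFrame c e (onSpacetime c R) a x) =
      G.metric c x (G.cov c X (G.e4 c) x) (e a x) -
      G.lapse c x * along (e a) (onSpacetime c R) x *
        G.metric c x (G.cov c X (G.e4 c) x) (G.e3 c x) -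
      2 * (G.lapse c x * along X (along (e a) (onSpacetime c R)) x +
        along X (G.lapse c) x * along (e a) (onSpacetime c R) x) -
      2 * G.lapse c x * ∑ b, along (e b) (onSpacetime c R) x *
        G.metric c x (G.cov c X (e b) x) (e a x) -
      2 * G.lapse c x ^ 2 * along (e a) (onSpacetime c R) x *
        ∑ b, along (e b) (onSpacetime c R) x * G.metric c x (G.cov c X (G.e3 c) x) (e b x) +
      G.lapse c x ^ 2 * gradSq e (onSpacetime c R) x *
        G.metric c x (G.cov c X (G.e3 c) x) (e a x) := by
  have hx := hUdom hxU
  have hΩ := differentiableAt_lapse hc hx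
  have hRd := differentiableAt_along_frame_onSpacetime hc hU hUdom he hR hxU
  have he3 := differentiableAt_e3 hc hx
  have he4 := differentiableAt_e4 hc hx
  have hed := he.differentiableAt hU hxU
  have hh : ∀ b, DifferentiableAt ℝ
      (fun y => 2 * (G.lapse c y * along (e b) (onSpacetime c R) y)) x := fun b =>
    (hΩ.fun_mul (hRd b)).const_mul 2
  have hk : DifferentiableAt ℝ
      (fun y => G.lapse c y ^ 2 * gradSq e (onSpacetime c R) y) x := by
    unfold gradSq
    fun_prop
  have hhX : ∀ b, along X (fun y => 2 * (G.lapse c y * along (e b) (onSpacetime c R) y)) x =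
      2 * (G.lapse c x * along X (along (e b) (onSpacetime c R)) x +
        along X (G.lapse c) x * along (e b) (onSpacetime c R) x) := by
    intro b
    rw [along_mul (differentiableAt_const _) (hΩ.fun_mul (hRd b)), along_const, zero_mul, add_zero,
      along_mul hΩ (hRd b)]
  have hfun : G.defE4 c e (onSpacetime c R) = fun y => (G.e4 c y -
      (2 * (G.lapse c y * along (e 0) (onSpacetime c R) y)) • e 0 y -
      (2 * (G.lapse c y * along (e 1) (onSpacetime c R) y)) • e 1 y) +
      (G.lapse c y ^ 2 * gradSq e (onSpacetime c R) y) • G.e3 c y := by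
    ext y i
    simp only [defE4, Fin.sum_univ_two, Pi.add_apply, Pi.sub_apply, Pi.smul_apply, smul_eq_mul]
    ring
  have horth : ∀ b, G.metric c x (e b x) (e a x) = if b = a then 1 else 0 := fun b =>
    he.orthonormal b a x hxU
  have h3 : ∀ b, G.metric c x (e b x) (G.e3 c x) = 0 := fun b => by
    rw [metric_e3_right hx, (he.tangent b x hxU).2, mul_zero]
  have h3' : ∀ b, G.metric c x (G.e3 c x) (e b x) = 0 := fun b => by
    rw [metric_symm hx, h3]
  have hb3 := metric_cov_frame_e3 hc hU hUdom he hxU X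
  rw [hfun, cov_add G c X ((he4.fun_sub ((hh 0).fun_smul (hed 0))).fun_sub ((hh 1).fun_smul (hed 1)))
      (hk.fun_smul he3),
    cov_sub G c X (he4.fun_sub ((hh 0).fun_smul (hed 0))) ((hh 1).fun_smul (hed 1)),
    cov_sub G c X he4 ((hh 0).fun_smul (hed 0)), cov_smul G c X (hh 0) (hed 0),
    cov_smul G c X (hh 1) (hed 1), cov_smul G c X hk he3, hhX, hhX]
  -- The derivative of the coefficient `Ω²|∇R|²` disappears, since `e₃` is orthogonal to `e'_a`.
  simp only [defFrame, metric_add_left, metric_sub_left, metric_smul_left, metric_sub_right,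
    metric_smul_right, hb3, metric_cov_e3_e3 hc hU hUdom he hxU, horth, metric_e3_e3 hx,
    h3, h3', Fin.sum_univ_two]
  fin_cases a <;> simp <;> ring

/-- The outgoing null expansion of the deformed sphere in terms of the frame Laplacian. -/
lemma trChiDef_eq : G.trChiDef c e (onSpacetime c R) x = G.trChi c e x -
    2 * G.lapse c x * G.frameLaplacian c e (onSpacetime c R) x -
    4 * G.lapse c x * ∑ a, G.eta c e a x * along (e a) (onSpacetime c R) x -
    4 * G.lapse c x ^ 2 * ∑ a, ∑ b, G.chib c e a b x * along (e a) (onSpacetime c R) x *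
      along (e b) (onSpacetime c R) x +
    G.lapse c x ^ 2 * G.trChib c e x * gradSq e (onSpacetime c R) x -
    8 * G.lapse c x ^ 2 * G.omegab c x * gradSq e (onSpacetime c R) x := by
  have hΩ := (lapse_pos (hUdom hxU)).ne'
  have hX : ∀ a, G.cov c (G.defFrame c e (onSpacetime c R) a) (G.defE4 c e (onSpacetime c R)) x =
      G.cov c (e a) (G.defE4 c e (onSpacetime c R)) x -
        (G.lapse c x * along (e a) (onSpacetime c R) x) •
          G.cov c (G.e3 c) (G.defE4 c e (onSpacetime c R)) x := fun a =>
    cov_sub_smul_left G c (e a) (G.e3 c) _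
      (fun y => G.lapse c y * along (e a) (onSpacetime c R) y) x
  have hω : G.metric c x (G.cov c (G.e3 c) (G.e4 c) x) (G.e3 c x) = -4 * G.omegab c x := by
    unfold omegab; ring
  have h1 := sum_chib_mul_along hc hU hUdom he hR hxU
  have hF := metric_cov_frame_frame hc hU hUdom he hxU
  have hF00 := hF (G.e3 c) 0 0
  have hF01 := hF (G.e3 c) 0 1
  have hF11 := hF (G.e3 c) 1 1
  have hG0 := hF (e 0) 0 1
  have hG1 := hF (e 1) 0 1
  have hG00 := hF (e 0) 0 0
  have hG11 := hF (e 1) 1 1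
  have hchib : ∀ a b, G.metric c x (G.cov c (e a) (G.e3 c) x) (e b x) = G.chib c e a b x :=
    fun _ _ => rfl
  have hchi : ∀ a b, G.metric c x (G.cov c (e a) (G.e4 c) x) (e b x) = G.chi c e a b x :=
    fun _ _ => rfl
  have h33 := metric_cov_e3_e3_frame hc hU hUdom he hxU
  have hL := along_e3_lapse hc hU hUdom he hxU
  -- `ρ_a = e_a log Ω`. It enters through `g(D_a e₄, e₃)` and through the derivative of the
  -- coefficient `2Ω e_a(R)`, with opposite signs.
  obtain ⟨ρ, hρ⟩ : ∃ ρ : Fin 2 → ℝ, ∀ a, along (e a) (G.lapse c) x = G.lapse c x * ρ a :=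
    ⟨fun a => along (e a) (G.lapse c) x / G.lapse c x, fun a => by field_simp⟩
  have hζ : ∀ a, G.metric c x (G.cov c (e a) (G.e4 c) x) (G.e3 c x) =
      2 * G.eta c e a x - 2 * ρ a := fun a => by
    rw [metric_cov_frame_e4_e3 hc hU hUdom he hxU, hρ]; field_simp
  unfold trChiDef
  simp only [hX, metric_sub_left, metric_smul_left,
    metric_cov_defE4_defFrame hc hU hUdom he hR hxU,
    hζ, hρ, metric_cov_e3_e4_frame hc hU hUdom he hxU,
    hω, h33, hL, hchib, hchi, frameLaplacian, trChi, trChib]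
  simp only [gradSq, Fin.sum_univ_two] at h1 ⊢
  generalize along (e 0) (onSpacetime c R) x = R0 at *
  generalize along (e 1) (onSpacetime c R) x = R1 at *
  generalize G.lapse c x = L at *
  -- The `hG` terms turn `g(D_a e_b, e_a)` into `-g(D_a e_a, e_b)`, completing `eᵃe_a(R)`; the `hF`
  -- terms remove the rotation along `e₃`. Through `h1`, the term `R_a e₃(e_a R)` supplies the
  -- second half of `-4Ω² χ̲(∇R, ∇R)`.
  linear_combination (-2 * L * R0) * hG00 + (-2 * L * R1) * hG0 + (-2 * L * R0) * hG1 +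
    (-2 * L * R1) * hG11 + L ^ 2 * R0 ^ 2 * hF00 + 2 * L ^ 2 * R0 * R1 * hF01 +
    L ^ 2 * R1 ^ 2 * hF11 + 2 * L ^ 2 * h1

end

end DoubleNull

theorem mainTheorem5 (G : DoubleNull) (ub : ℝ) (R : S2 → ℝ)
    (hR : ContMDiff (𝓡 2) 𝓘(ℝ, ℝ) 2 R)
    (hM : ∀ q : S2, (1 - R q, ub) ∈ G.dom)
    (c : Chart) (hc : c ∈ IsManifold.maximalAtlas (𝓡 2) ∞ S2)
    (q : S2) (hq : q ∈ c.source)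
    (U : Set Coord) (hU : IsOpen U) (hUdom : U ⊆ G.coordDom c)
    (hp : pt (1 - R q) ub (c q) ∈ U)
    (e : Fin 2 → Coord → Coord) (he : G.IsSphereFrame c U e) :
    let p : Coord := pt (1 - R q) ub (c q)
    let Rs : Coord → ℝ := onSpacetime c R
    let Ω : ℝ := G.lapse c p
    G.frameLaplacian c e Rs p = G.sphereLaplacian c (1 - R q) ub R (c q) ∧
    G.frameLaplacian c e Rs p = G.deformedLaplacian c ub R R (c q)
      - 2 * Ω * ∑ a, ∑ b, G.chibHat c e a b p * along (e a) Rs p * along (e b) Rs p ∧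
    G.trChiDef c e Rs p = G.trChi c e p
      - 2 * Ω * G.deformedLaplacian c ub R R (c q)
      - 4 * Ω * ∑ a, G.eta c e a p * along (e a) Rs p
      - Ω ^ 2 * G.trChib c e p * DoubleNull.gradSq e Rs p
      - 8 * Ω ^ 2 * G.omegab c p * DoubleNull.gradSq e Rs p := by
  intro p Rs Ω
  have hθ : c q ∈ c.target := c.map_source hq
  have hsphere : G.frameLaplacian c e Rs p = G.sphereLaplacian c (1 - R q) ub R (c q) := by
    -- On the round section `u = const` the slope `s` is zero and no correction appears.
    have h := DoubleNull.laplaceBeltrami_inducedMetric_pt hc hU hUdom he hR (θ := c q) (ub := ub)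
      (w := fun _ => 1 - R q) (s := 0) (by simp) (fun A => by simp [partialDeriv]) hp
    rw [zero_mul, zero_mul, add_zero] at h
    exact h.symm
  have hdeformed : G.deformedLaplacian c ub R R (c q) = G.frameLaplacian c e Rs p +
      2 * Ω * ∑ a, ∑ b, G.chibHat c e a b p * along (e a) Rs p * along (e b) Rs p := by
    have hw : 1 - R (c.symm (c q)) = 1 - R q := by rw [c.left_inv hq]
    have hd : ∀ᶠ y in 𝓝 (c q), DifferentiableAt ℝ (fun y => R (c.symm y)) y := by
      filter_upwards [c.open_target.mem_nhds hθ] with y hy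
        using differentiableAt_comp_chart_symm hc hR hy
    have h := DoubleNull.laplaceBeltrami_inducedMetric_pt hc hU hUdom he hR (θ := c q) (ub := ub)
      (w := fun y => 1 - R (c.symm y)) (s := 1)
      (by filter_upwards [hd] with y hy using hy.const_sub 1)
      (fun A => by
        rw [partialDeriv_sub (differentiableAt_const _) hd.self_of_nhds]
        simp [partialDeriv])
      (by rw [hw]; exact hp)
    simp only [hw, one_mul] at h
    rw [DoubleNull.sum_chibHat_mul_along hc hU hUdom he hR hp, ang_pt]
    exact h
  have hexp := DoubleNull.trChiDef_eq hc hU hUdom he hR hp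
  refine ⟨hsphere, by rw [hdeformed]; ring, ?_⟩
  -- `4Ω² (χ̲̂ - χ̲)(∇R, ∇R) = -2Ω² tr χ̲ |∇R|²`, which changes the coefficient of `Ω² tr χ̲ |∇R|²`
  -- from `+1` to `-1`.
  rw [hdeformed, hexp]
  simp only [DoubleNull.chibHat, DoubleNull.gradSq, Fin.sum_univ_two, if_true, zero_ne_one,
    one_ne_zero, if_false]
  ring
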